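/- Let $R$ be an associative ring with identity and let $M$ be an $R$-bimodule which is $N$-nilpotent for some integer $N\ge 0$, i.e. $M^{N+1}=0$, where $M^0=R$ and $M^{i+1}=M\otimes_R M^i$. Let $T_R(M)=\bigoplus_{i\ge 0}M^i$ be the tensor ring. Modules are left modules. A $T_R(M)$-module is written as a pair $(X,u)$, where $X$ is an $R$-module and $u:M\otimes_R X\to X$ is an $R$-homomorphism (an element $m\in M$ acts on $X$ by $x\mapsto u(m\otimes x)$). For an $R$-module $X$ let $\mathrm{Ind}(X)=\big(\bigoplus_{i\ge 0}(M^i\otimes_R X),\,c_X\big)$, where $c_X$ identifies $M\otimes_R(M^i\otimes_R X)$ with the summand $M^{i+1}\otimes_R X$. For a ring $S$, an $S$-module $C$ is cotorsion if $\mathrm{Ext}^1_S(F,C)=0$ for every flat $S$-module $F$; let $\mathrm{FC}(S)$ be the class of $S$-modules that are both flat and cotorsion. A totally acyclic complex of flat-cotorsion $S$-modules is an exact complex $T^\bullet=(\cdots\to T^{-1}\to T^0\to T^1\to\cdots)$ with all $T^i\in \mathrm{FC}(S)$ such that $\mathrm{Hom}_S(T^\bullet,W)$ is exact for every $W\in\mathrm{FC}(S)$.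 An $S$-module is Gorenstein flat-cotorsion if it is isomorphic to $\mathrm{Ker}(T^0\to T^1)$ for such a complex $T^\bullet$. The bimodule $M$ is called compatible if, for every totally acyclic complex $T^\bullet$ of flat-cotorsion $T_R(M)$-modules, the complex $M\otimes_R T^\bullet$ is acyclic, and the complex $\mathrm{Hom}_{T_R(M)}(T^\bullet,\mathrm{Ind}(M\otimes_R F))$ is acyclic for every $F\in\mathrm{FC}(R)$. **Proposition.** Suppose that $M\otimes_R C$ is a cotorsion $R$-module for every cotorsion $R$-module $C$, and that $M$ is compatible. If $(X,u)$ is a Gorenstein flat-cotorsion $T_R(M)$-module, then $u$ is a monomorphism and $\mathrm{Coker}\,u$ is a Gorenstein flat-cotorsion $R$-module. -/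

import Mathlib

open CategoryTheory DirectSum
open scoped TensorProduct

universe u

noncomputable section

/-! ### Tensor products over a not necessarily commutative ring -/

section BalTensor

variable (R : Type u) [Ring R]

/-- The relations `(a · r) ⊗ x = a ⊗ (r • x)` inside `A ⊗[ℤ] X`, for a right `R`-module `A`
(that is, a module over the opposite ring) and a left `R`-module `X`. -/
def balRel (A X : Type u) [AddCommGroup A] [Module Rᵐᵒᵖ A] [AddCommGroup X] [Module R X] :
    AddSubgroup (A ⊗[ℤ] X) :=
  AddSubgroup.closure
    {t | ∃ (a : A) (r : R) (x : X), t = (MulOpposite.op r • a) ⊗ₜ[ℤ] x - a ⊗ₜ[ℤ] (r • x)}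

/-- The tensor product `A ⊗_R X` of a right `R`-module `A` and a left `R`-module `X`,
as an abelian group. -/
def BalTensor (A X : Type u) [AddCommGroup A] [Module Rᵐᵒᵖ A] [AddCommGroup X] [Module R X] :
    Type u :=
  (A ⊗[ℤ] X) ⧸ balRel R A X

namespace BalTensor

section Basic

variable {A X : Type u} [AddCommGroup A] [Module Rᵐᵒᵖ A] [AddCommGroup X] [Module R X]

instance : AddCommGroup (BalTensor R A X) :=
  inferInstanceAs (AddCommGroup ((A ⊗[ℤ] X) ⧸ balRel R A X))

/-- The quotient map `A ⊗[ℤ] X → A ⊗_R X`. -/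
def proj (A X : Type u) [AddCommGroup A] [Module Rᵐᵒᵖ A] [AddCommGroup X] [Module R X] :
    A ⊗[ℤ] X →+ BalTensor R A X :=
  QuotientAddGroup.mk' (balRel R A X)

lemma proj_surjective : Function.Surjective (proj R A X) :=
  QuotientAddGroup.mk'_surjective (balRel R A X)

lemma proj_eq_zero {t : A ⊗[ℤ] X} (ht : t ∈ balRel R A X) : proj R A X t = 0 :=
  (QuotientAddGroup.eq_zero_iff t).2 ht

/-- The elementary tensor `a ⊗ x` in `A ⊗_R X`. -/
def tmul (a : A) (x : X) : BalTensor R A X := proj R A X (a ⊗ₜ[ℤ] x)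

lemma tmul_add (a : A) (x y : X) : tmul R a (x + y) = tmul R a x + tmul R a y := by
  simp only [tmul, TensorProduct.tmul_add, map_add]

lemma add_tmul (a b : A) (x : X) : tmul R (a + b) x = tmul R a x + tmul R b x := by
  simp only [tmul, TensorProduct.add_tmul, map_add]

@[simp]
lemma tmul_zero (a : A) : tmul R a (0 : X) = 0 := by
  simp only [tmul, TensorProduct.tmul_zero, map_zero]

@[simp]
lemma zero_tmul (x : X) : tmul R (0 : A) x = 0 := by
  simp only [tmul, TensorProduct.zero_tmul, map_zero]

lemma op_smul_tmul (r : R) (a : A) (x : X) :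
    tmul R (MulOpposite.op r • a) x = tmul R a (r • x) := by
  rw [← sub_eq_zero, tmul, tmul, ← map_sub]
  exact proj_eq_zero R (AddSubgroup.subset_closure ⟨a, r, x, rfl⟩)

variable {R}

@[elab_as_elim]
lemma induction_on {p : BalTensor R A X → Prop} (t : BalTensor R A X)
    (zero : p 0) (tmul : ∀ a x, p (tmul R a x)) (add : ∀ s t, p s → p t → p (s + t)) : p t := by
  obtain ⟨t, rfl⟩ := proj_surjective R t
  induction t using TensorProduct.induction_on with
  | zero => rw [map_zero]; exact zero
  | tmul a x => exact tmul a x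
  | add s t hs ht => rw [map_add]; exact add _ _ hs ht

/-- The additive map `A ⊗_R X → P` induced by a biadditive balanced map. -/
def lift {P : Type u} [AddCommGroup P] (f : A →+ X →+ P)
    (hf : ∀ (r : R) (a : A) (x : X), f (MulOpposite.op r • a) x = f a (r • x)) :
    BalTensor R A X →+ P :=
  QuotientAddGroup.lift (balRel R A X)
    (TensorProduct.liftAddHom f (fun n a x => by simp)) (by
      unfold balRel
      rw [AddSubgroup.closure_le]
      rintro _ ⟨a, r, x, rfl⟩
      simp [hf])

@[simp]
lemma lift_tmul {P : Type u} [AddCommGroup P] (f : A →+ X →+ P)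
    (hf : ∀ (r : R) (a : A) (x : X), f (MulOpposite.op r • a) x = f a (r • x)) (a : A) (x : X) :
    lift f hf (tmul R a x) = f a x := rfl

/-- The biadditive map `(a, x) ↦ a ⊗ x`. -/
def mk (R : Type u) [Ring R] (A X : Type u) [AddCommGroup A] [Module Rᵐᵒᵖ A]
    [AddCommGroup X] [Module R X] : A →+ X →+ BalTensor R A X :=
  AddMonoidHom.mk' (fun a => AddMonoidHom.mk' (fun x => tmul R a x) (tmul_add R a))
    (fun a b => by ext x; exact add_tmul R a b x)

@[simp]
lemma mk_apply (a : A) (x : X) : mk R A X a x = tmul R a x := rfl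

/-- `f ⊗ X : A ⊗_R X → B ⊗_R X` for a homomorphism `f : A → B` of right `R`-modules. -/
def rTensor {B : Type u} [AddCommGroup B] [Module Rᵐᵒᵖ B]
    (X : Type u) [AddCommGroup X] [Module R X] (f : A →ₗ[Rᵐᵒᵖ] B) :
    BalTensor R A X →+ BalTensor R B X :=
  lift ((mk R B X).comp f.toAddMonoidHom) (fun r a x => by
    simp [op_smul_tmul])

/-- `A ⊗ f : A ⊗_R X → A ⊗_R Y` for a homomorphism `f : X → Y` of left `R`-modules. -/
def lTensor {Y : Type u} [AddCommGroup Y] [Module R Y]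
    (A : Type u) [AddCommGroup A] [Module Rᵐᵒᵖ A] (f : X →ₗ[R] Y) :
    BalTensor R A X →+ BalTensor R A Y :=
  lift ((AddMonoidHom.compHom' f.toAddMonoidHom).comp (mk R A Y)) (fun r a x => by
    simp [op_smul_tmul])

end Basic

section Bimodule

variable {R}
variable {M X : Type u} [AddCommGroup M] [Module R M] [Module Rᵐᵒᵖ M] [SMulCommClass R Rᵐᵒᵖ M]
  [AddCommGroup X] [Module R X]

/-- Left multiplication by `r` on `M ⊗_R X` for an `R`-bimodule `M`. -/
def lsmul (M X : Type u) [AddCommGroup M] [Module R M] [Module Rᵐᵒᵖ M] [SMulCommClass R Rᵐᵒᵖ M]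
    [AddCommGroup X] [Module R X] (r : R) : BalTensor R M X →+ BalTensor R M X :=
  lift ((mk R M X).comp (DistribSMul.toAddMonoidHom M r)) (fun s m x => by
    simp [smul_comm r, op_smul_tmul])

instance : SMul R (BalTensor R M X) := ⟨fun r t => lsmul M X r t⟩

lemma smul_tmul' (r : R) (m : M) (x : X) : r • tmul R m x = tmul R (r • m) x := rfl

/-- For an `R`-bimodule `M`, the tensor product `M ⊗_R X` is a left `R`-module through
`r • (m ⊗ x) = (r • m) ⊗ x`. -/
instance : Module R (BalTensor R M X) where
  smul_zero r := map_zero (lsmul M X r)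
  smul_add r := map_add (lsmul M X r)
  one_smul t := by
    induction t using induction_on with
    | zero => exact map_zero (lsmul M X 1)
    | tmul m x => rw [smul_tmul', one_smul]
    | add s t hs ht => exact (map_add (lsmul M X 1) s t).trans (congrArg₂ (· + ·) hs ht)
  mul_smul r r' t := by
    induction t using induction_on with
    | zero =>
      change lsmul M X _ 0 = lsmul M X _ (lsmul M X _ 0)
      simp
    | tmul m x => rw [smul_tmul', smul_tmul', smul_tmul', mul_smul]
    | add s t hs ht =>
      change lsmul M X _ (s + t) = lsmul M X _ (lsmul M X _ (s + t))
      rw [map_add, map_add, map_add]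
      exact congrArg₂ (· + ·) hs ht
  add_smul r r' t := by
    induction t using induction_on with
    | zero =>
      change lsmul M X _ 0 = lsmul M X _ 0 + lsmul M X _ 0
      simp
    | tmul m x => rw [smul_tmul', smul_tmul', smul_tmul', add_smul, add_tmul]
    | add s t hs ht =>
      change lsmul M X _ (s + t) = lsmul M X _ (s + t) + lsmul M X _ (s + t)
      rw [map_add, map_add, map_add, add_add_add_comm]
      exact congrArg₂ (· + ·) hs ht
  zero_smul t := by
    induction t using induction_on with
    | zero => exact map_zero (lsmul M X 0)
    | tmul m x =>
      rw [smul_tmul', zero_smul, zero_tmul]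
    | add s t hs ht =>
      exact (map_add (lsmul M X 0) s t).trans ((congrArg₂ (· + ·) hs ht).trans (add_zero 0))

/-- The `R`-linear map `M ⊗_R X → P` induced by a balanced map that is `R`-linear in the
bimodule variable and additive in the other one. -/
def liftLin {P : Type u} [AddCommGroup P] [Module R P] (f : M →ₗ[R] X →+ P)
    (hf : ∀ (r : R) (m : M) (x : X), f (MulOpposite.op r • m) x = f m (r • x)) :
    BalTensor R M X →ₗ[R] P where
  toFun := lift f.toAddMonoidHom (fun r a x => by simpa using hf r a x)
  map_add' := map_add _
  map_smul' r t := by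
    induction t using induction_on with
    | zero => simp
    | tmul m x =>
      rw [smul_tmul', lift_tmul, lift_tmul]
      simp
    | add s t hs ht => rw [smul_add, map_add, map_add, hs, ht, smul_add]

@[simp]
lemma liftLin_tmul {P : Type u} [AddCommGroup P] [Module R P] (f : M →ₗ[R] X →+ P)
    (hf : ∀ (r : R) (m : M) (x : X), f (MulOpposite.op r • m) x = f m (r • x)) (m : M) (x : X) :
    liftLin f hf (tmul R m x) = f m x := rfl

end Bimodule

end BalTensor

end BalTensor

/-! ### Flat, cotorsion and Gorenstein flat-cotorsion modules -/

section GFC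

variable (S : Type u) [Ring S]

/-- A left `S`-module `F` is flat if `- ⊗_S F` preserves injectivity of homomorphisms of right
`S`-modules. -/
def IsFlatModule (F : Type u) [AddCommGroup F] [Module S F] : Prop :=
  ∀ (A B : Type u) [AddCommGroup A] [AddCommGroup B] [Module Sᵐᵒᵖ A] [Module Sᵐᵒᵖ B]
    (f : A →ₗ[Sᵐᵒᵖ] B), Function.Injective f → Function.Injective (BalTensor.rTensor F f)

/-- A left `S`-module `C` is cotorsion if `Ext¹_S(F, C) = 0` for all flat `S`-modules `F`. -/
def IsCotorsionModule (C : Type u) [AddCommGroup C] [Module S C] : Prop :=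
  ∀ (F : Type u) [AddCommGroup F] [Module S F], IsFlatModule S F →
    Subsingleton (Abelian.Ext.{u} (ModuleCat.of S F) (ModuleCat.of S C) 1)

/-- The class `FC(S)` of flat-cotorsion modules. -/
def IsFlatCotorsion (C : Type u) [AddCommGroup C] [Module S C] : Prop :=
  IsFlatModule S C ∧ IsCotorsionModule S C

variable {S}

/-- The complex of abelian groups `Hom_S(T, W)` is acyclic:
`Hom_S(Tⁱ⁺¹, W) → Hom_S(Tⁱ, W) → Hom_S(Tⁱ⁻¹, W)` is exact for every `i`. -/
def HomComplexAcyclic (T : CochainComplex (ModuleCat.{u} S) ℤ)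
    (W : Type u) [AddCommGroup W] [Module S W] : Prop :=
  ∀ i : ℤ, Function.Exact
    (fun g : T.X (i + 1) →ₗ[S] W => g ∘ₗ (T.d i (i + 1)).hom)
    (fun g : T.X i →ₗ[S] W => g ∘ₗ (T.d (i - 1) i).hom)

/-- Totally acyclic complexes of flat-cotorsion modules. -/
structure IsTotallyAcyclicFC (T : CochainComplex (ModuleCat.{u} S) ℤ) : Prop where
  flatCotorsion : ∀ i : ℤ, IsFlatCotorsion S (T.X i)
  exact : ∀ i : ℤ, Function.Exact (T.d (i - 1) i).hom (T.d i (i + 1)).hom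
  hom_acyclic : ∀ (W : Type u) [AddCommGroup W] [Module S W], IsFlatCotorsion S W →
    HomComplexAcyclic T W

variable (S)

/-- An `S`-module is Gorenstein flat-cotorsion if it is isomorphic to `Ker(T⁰ → T¹)` for a
totally acyclic complex `T` of flat-cotorsion modules. -/
def IsGorensteinFlatCotorsion (X : Type u) [AddCommGroup X] [Module S X] : Prop :=
  ∃ T : CochainComplex (ModuleCat.{u} S) ℤ, IsTotallyAcyclicFC T ∧
    Nonempty (X ≃ₗ[S] LinearMap.ker (T.d 0 1).hom)

end GFC

/-! ### The tensor ring of a bimodule and its modules -/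

section TensorRing

variable (R : Type u) [Ring R] (M : Type u) [AddCommGroup M] [Module R M] [Module Rᵐᵒᵖ M]
  [SMulCommClass R Rᵐᵒᵖ M]

/-- The left `R`-module `Mⁱ ⊗_R X`, bracketed to the right:
`M⁰ ⊗_R X = X` and `Mⁱ⁺¹ ⊗_R X = M ⊗_R (Mⁱ ⊗_R X)`. -/
def tpowTensor (X : ModuleCat.{u} R) : ℕ → ModuleCat.{u} R
  | 0 => X
  | i + 1 => ModuleCat.of R (BalTensor R M (tpowTensor X i))

/-- The identification `X = M⁰ ⊗_R X`. -/
def tpowZero (X : ModuleCat.{u} R) : X ≃ₗ[R] tpowTensor R M X 0 := LinearEquiv.refl R X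

/-- The identification `M ⊗_R (Mⁱ ⊗_R X) = Mⁱ⁺¹ ⊗_R X`. -/
def tpowSucc (X : ModuleCat.{u} R) (i : ℕ) :
    BalTensor R M (tpowTensor R M X i) ≃ₗ[R] tpowTensor R M X (i + 1) :=
  LinearEquiv.refl R (BalTensor R M (tpowTensor R M X i))

/-- The tensor power `Mⁱ`: `M⁰ = R` and `Mⁱ⁺¹ = M ⊗_R Mⁱ`. -/
abbrev tpow (i : ℕ) : ModuleCat.{u} R := tpowTensor R M (ModuleCat.of R R) i

/-- `M` is `N`-nilpotent: `M^(N+1) = 0`. -/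
def IsNilpotentBimodule (N : ℕ) : Prop := Subsingleton (tpow R M (N + 1))

/-- The left `R`-module `⨁ᵢ (Mⁱ ⊗_R X)`. If `M` is `N`-nilpotent, the summands with `i > N`
vanish. -/
abbrev IndCarrier (X : Type u) [AddCommGroup X] [Module R X] : Type u :=
  ⨁ i : ℕ, tpowTensor R M (ModuleCat.of R X) i

/-- The inclusion of the summand `Mⁱ ⊗_R X` into `⨁ᵢ (Mⁱ ⊗_R X)`. -/
def indOf (X : Type u) [AddCommGroup X] [Module R X] (i : ℕ) :
    tpowTensor R M (ModuleCat.of R X) i →ₗ[R] IndCarrier R M X :=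
  DirectSum.lof R ℕ (fun j : ℕ => tpowTensor R M (ModuleCat.of R X) j) i

/-- For `m ∈ M`, the additive map `⨁ᵢ (Mⁱ ⊗_R X) → ⨁ᵢ (Mⁱ ⊗_R X)` which sends `y` in the summand
of index `i` to `m ⊗ y` in the summand of index `i + 1`. -/
def indShift (X : Type u) [AddCommGroup X] [Module R X] (m : M) :
    IndCarrier R M X →+ IndCarrier R M X :=
  DirectSum.toAddMonoid fun i =>
    ((indOf R M X (i + 1)).toAddMonoidHom.comp
      (tpowSucc R M (ModuleCat.of R X) i).toLinearMap.toAddMonoidHom).comp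
        (BalTensor.mk R M (tpowTensor R M (ModuleCat.of R X) i) m)

lemma indShift_of (X : Type u) [AddCommGroup X] [Module R X] (m : M) (i : ℕ)
    (y : tpowTensor R M (ModuleCat.of R X) i) :
    indShift R M X m (indOf R M X i y) =
      indOf R M X (i + 1) (tpowSucc R M (ModuleCat.of R X) i (BalTensor.tmul R m y)) :=
  DirectSum.toAddMonoid_of _ _ _

/-- The structure map `c_X : M ⊗_R (⨁ᵢ (Mⁱ ⊗_R X)) → ⨁ᵢ (Mⁱ ⊗_R X)`, which identifies
`M ⊗_R (Mⁱ ⊗_R X)` with the summand of index `i + 1`. -/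
def indMap (X : Type u) [AddCommGroup X] [Module R X] :
    BalTensor R M (IndCarrier R M X) →ₗ[R] IndCarrier R M X :=
  BalTensor.liftLin
    { toFun := indShift R M X
      map_add' := fun m m' => by
        refine DirectSum.addHom_ext fun i y => ?_
        change indShift R M X (m + m') (indOf R M X i y) =
          indShift R M X m (indOf R M X i y) + indShift R M X m' (indOf R M X i y)
        rw [indShift_of, indShift_of, indShift_of, BalTensor.add_tmul, map_add, map_add]
      map_smul' := fun r m => by
        refine DirectSum.addHom_ext fun i y => ?_
        change indShift R M X (r • m) (indOf R M X i y) =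
          r • indShift R M X m (indOf R M X i y)
        rw [indShift_of, indShift_of, ← BalTensor.smul_tmul', map_smul, map_smul] }
    (fun r m x => by
      change indShift R M X (MulOpposite.op r • m) x = indShift R M X m (r • x)
      induction x using DirectSum.induction_on with
      | zero => simp
      | of i y =>
        change indShift R M X (MulOpposite.op r • m) (indOf R M X i y) =
          indShift R M X m (r • indOf R M X i y)
        rw [← map_smul, indShift_of, indShift_of, BalTensor.op_smul_tmul]
      | add x y hx hy => rw [smul_add, map_add, map_add, hx, hy])

lemma indMap_tmul_of (X : Type u) [AddCommGroup X] [Module R X] (m : M) (i : ℕ)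
    (y : tpowTensor R M (ModuleCat.of R X) i) :
    indMap R M X (BalTensor.tmul R m (indOf R M X i y)) =
      indOf R M X (i + 1) (tpowSucc R M (ModuleCat.of R X) i (BalTensor.tmul R m y)) :=
  indShift_of R M X m i y

/-- The tensor ring `T_R(M) = ⨁ᵢ Mⁱ`, as a type. -/
def TensorRing : Type u := ⨁ i : ℕ, tpow R M i

namespace TensorRing

instance : AddCommGroup (TensorRing R M) := inferInstanceAs (AddCommGroup (⨁ i : ℕ, tpow R M i))

instance : Module R (TensorRing R M) := inferInstanceAs (Module R (⨁ i : ℕ, tpow R M i))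

variable {R M}

section Action

variable {X : Type u} [AddCommGroup X] [Module R X] (u : BalTensor R M X →ₗ[R] X)

/-- The action of `R` on `X` by scalar multiplication. -/
def actScalar {X : Type u} [AddCommGroup X] [Module R X] : R →ₗ[R] (X →+ X) where
  toFun r := DistribSMul.toAddMonoidHom X r
  map_add' r s := by ext x; exact add_smul r s x
  map_smul' r s := by ext x; exact mul_smul r s x

/-- Given a map `φ` from `Y` to the additive endomorphisms of `X`, the map from `M ⊗_R Y` to these
endomorphisms which sends `m ⊗ y` to `x ↦ u (m ⊗ φ y x)`. -/
def actStep {Y : Type u} [AddCommGroup Y] [Module R Y] (φ : Y →ₗ[R] (X →+ X)) :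
    BalTensor R M Y →ₗ[R] (X →+ X) :=
  BalTensor.liftLin
    { toFun := fun m => AddMonoidHom.mk' (fun y =>
          (u.toAddMonoidHom.comp (BalTensor.mk R M X m)).comp (φ y))
        (fun y y' => by ext x; simp [BalTensor.tmul_add])
      map_add' := fun m m' => by ext y x; simp
      map_smul' := fun r m => by ext y x; simp [← BalTensor.smul_tmul'] }
    (fun r m y => by ext x; simp [BalTensor.op_smul_tmul])

/-- For a pair `(X, u)`, the action of `Mⁱ` on `X`: `M⁰ = R` acts by scalar multiplication and
`m ⊗ y ∈ M ⊗_R Mⁱ` acts by `x ↦ u (m ⊗ (y • x))`. -/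
def actPow : (i : ℕ) → tpow R M i →ₗ[R] (X →+ X)
  | 0 => actScalar.comp (tpowZero R M (ModuleCat.of R R)).symm.toLinearMap
  | i + 1 => (actStep u (actPow i)).comp (tpowSucc R M (ModuleCat.of R R) i).symm.toLinearMap

/-- For a pair `(X, u)`, the action of `T_R(M)` on `X`. -/
def act : TensorRing R M →ₗ[R] (X →+ X) := DirectSum.toModule R ℕ (X →+ X) (actPow u)

end Action

/-- The inclusion of `Mⁱ` into `T_R(M)`. -/
def of (R : Type u) [Ring R] (M : Type u) [AddCommGroup M] [Module R M] [Module Rᵐᵒᵖ M]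
    [SMulCommClass R Rᵐᵒᵖ M] (i : ℕ) : tpow R M i →ₗ[R] TensorRing R M :=
  indOf R M R i

/-- The inclusion of `R = M⁰` into `T_R(M)`. -/
def scalar (R : Type u) [Ring R] (M : Type u) [AddCommGroup M] [Module R M] [Module Rᵐᵒᵖ M]
    [SMulCommClass R Rᵐᵒᵖ M] : R →ₗ[R] TensorRing R M :=
  (of R M 0).comp (tpowZero R M (ModuleCat.of R R)).toLinearMap

/-- The structure map `M ⊗_R T_R(M) → T_R(M)`, `m ⊗ y ↦ m ⊗ y`. -/
def shift (R : Type u) [Ring R] (M : Type u) [AddCommGroup M] [Module R M] [Module Rᵐᵒᵖ M]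
    [SMulCommClass R Rᵐᵒᵖ M] : BalTensor R M (TensorRing R M) →ₗ[R] TensorRing R M :=
  indMap R M R

lemma shift_tmul_of (m : M) (i : ℕ) (y : tpow R M i) :
    shift R M (BalTensor.tmul R m (of R M i y)) =
      of R M (i + 1) (tpowSucc R M (ModuleCat.of R R) i (BalTensor.tmul R m y)) :=
  indMap_tmul_of R M R m i y

@[elab_as_elim]
lemma induction_on {p : TensorRing R M → Prop} (t : TensorRing R M) (zero : p 0)
    (scalar : ∀ r : R, p (scalar R M r))
    (tmul : ∀ (m : M) (i : ℕ) (y : tpow R M i), p (of R M i y) →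
      p (shift R M (BalTensor.tmul R m (of R M i y))))
    (add : ∀ s t, p s → p t → p (s + t)) : p t := by
  have h : ∀ (i : ℕ) (y : tpow R M i), p (of R M i y) := by
    intro i
    induction i with
    | zero => exact scalar
    | succ i ih =>
      intro y
      obtain ⟨z, rfl⟩ := (tpowSucc R M (ModuleCat.of R R) i).surjective y
      induction z using BalTensor.induction_on with
      | zero => rw [map_zero, map_zero]; exact zero
      | tmul m y => rw [← shift_tmul_of]; exact tmul m i y (ih y)
      | add s t hs ht => rw [map_add, map_add]; exact add _ _ hs ht
  exact DirectSum.induction_on (motive := p) t zero h add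

section Action

variable {X : Type u} [AddCommGroup X] [Module R X] (u : BalTensor R M X →ₗ[R] X)

lemma act_of (i : ℕ) (y : tpow R M i) : act u (of R M i y) = actPow u i y :=
  DirectSum.toModule_lof (ι := ℕ) (M := fun i => tpow R M i) R (φ := actPow u) i y

lemma act_scalar (r : R) (x : X) : act u (scalar R M r) x = r • x := by
  rw [scalar, LinearMap.comp_apply, act_of]
  rfl

lemma act_shift (m : M) (t : TensorRing R M) (x : X) :
    act u (shift R M (BalTensor.tmul R m t)) x = u (BalTensor.tmul R m (act u t x)) := by
  have h : ∀ (i : ℕ) (y : tpow R M i), act u (shift R M (BalTensor.tmul R m (of R M i y))) x =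
      u (BalTensor.tmul R m (act u (of R M i y) x)) := by
    intro i y
    rw [shift_tmul_of, act_of, act_of]
    rfl
  have h0 : act u (shift R M (BalTensor.tmul R m (0 : TensorRing R M))) x =
      u (BalTensor.tmul R m (act u (0 : TensorRing R M) x)) := by
    simp
  have hadd : ∀ s t : TensorRing R M,
      act u (shift R M (BalTensor.tmul R m s)) x = u (BalTensor.tmul R m (act u s x)) →
      act u (shift R M (BalTensor.tmul R m t)) x = u (BalTensor.tmul R m (act u t x)) →
      act u (shift R M (BalTensor.tmul R m (s + t))) x =
        u (BalTensor.tmul R m (act u (s + t) x)) := by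
    intro s t hs ht
    simp only [BalTensor.tmul_add, map_add, AddMonoidHom.add_apply, hs, ht]
  exact DirectSum.induction_on (motive := fun t : TensorRing R M =>
    act u (shift R M (BalTensor.tmul R m t)) x = u (BalTensor.tmul R m (act u t x))) t h0 h hadd

end Action

/-- The multiplication of `T_R(M)`: the product of `a ∈ Mⁱ` and `b ∈ Mʲ` is `a ⊗ b` in
`Mⁱ⁺ʲ = Mⁱ ⊗_R Mʲ`; recursively, `r * b = r • b` for `r ∈ R = M⁰` and
`(m ⊗ y) * b = m ⊗ (y * b)`. -/
instance : Mul (TensorRing R M) := ⟨fun a b => act (shift R M) a b⟩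

instance : One (TensorRing R M) := ⟨scalar R M 1⟩

lemma mul_def (a b : TensorRing R M) : a * b = act (shift R M) a b := rfl

lemma one_def : (1 : TensorRing R M) = scalar R M 1 := rfl

lemma scalar_mul (r : R) (b : TensorRing R M) : scalar R M r * b = r • b :=
  act_scalar _ r b

lemma shift_mul (m : M) (t b : TensorRing R M) :
    shift R M (BalTensor.tmul R m t) * b = shift R M (BalTensor.tmul R m (t * b)) :=
  act_shift _ m t b

lemma add_mul' (a b c : TensorRing R M) : (a + b) * c = a * c + b * c := by
  rw [mul_def, map_add]; rfl

lemma act_mul {X : Type u} [AddCommGroup X] [Module R X] (u : BalTensor R M X →ₗ[R] X)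
    (a b : TensorRing R M) (x : X) : act u (a * b) x = act u a (act u b x) := by
  induction a using induction_on with
  | zero => simp [mul_def]
  | scalar r => rw [scalar_mul, map_smul, act_scalar]; rfl
  | tmul m i y ih => rw [shift_mul, act_shift, act_shift, ih]
  | add s t hs ht =>
    rw [add_mul', map_add, map_add, AddMonoidHom.add_apply, AddMonoidHom.add_apply, hs, ht]

lemma act_one {X : Type u} [AddCommGroup X] [Module R X] (u : BalTensor R M X →ₗ[R] X) (x : X) :
    act u (1 : TensorRing R M) x = x := by
  rw [one_def, act_scalar, one_smul]

instance : Ring (TensorRing R M) :=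
  { (inferInstance : AddCommGroup (TensorRing R M)), (inferInstance : Mul (TensorRing R M)),
    (inferInstance : One (TensorRing R M)) with
    left_distrib := fun a b c => map_add (act (shift R M) a) b c
    right_distrib := add_mul'
    zero_mul := fun a => by rw [mul_def, map_zero]; rfl
    mul_zero := fun a => map_zero (act (shift R M) a)
    mul_assoc := fun a b c => act_mul (shift R M) a b c
    one_mul := fun a => act_one (shift R M) a
    mul_one := fun a => by
      induction a using induction_on with
      | zero => rw [mul_def, map_zero]; rfl
      | scalar r => rw [scalar_mul, one_def, ← map_smul, smul_eq_mul, mul_one]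
      | tmul m i y ih => rw [shift_mul, ih]
      | add s t hs ht => rw [add_mul', hs, ht] }

/-- The ring homomorphism `R → T_R(M)` onto the summand `M⁰ = R`. -/
def incl (R : Type u) [Ring R] (M : Type u) [AddCommGroup M] [Module R M] [Module Rᵐᵒᵖ M]
    [SMulCommClass R Rᵐᵒᵖ M] : R →+* TensorRing R M where
  toFun := scalar R M
  map_one' := rfl
  map_zero' := map_zero _
  map_add' := map_add _
  map_mul' r s := by rw [scalar_mul, ← map_smul, smul_eq_mul]

/-- The `T_R(M)`-module `(X, u)`: the abelian group `X` on which `R` acts as given and `m ∈ M` acts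
by `x ↦ u (m ⊗ x)`. -/
def ModuleOfPair {X : Type u} [AddCommGroup X] [Module R X] (_u : BalTensor R M X →ₗ[R] X) :
    Type u := X

instance {X : Type u} [AddCommGroup X] [Module R X] (u : BalTensor R M X →ₗ[R] X) :
    AddCommGroup (ModuleOfPair u) := inferInstanceAs (AddCommGroup X)

instance {X : Type u} [AddCommGroup X] [Module R X] (u : BalTensor R M X →ₗ[R] X) :
    Module (TensorRing R M) (ModuleOfPair u) where
  smul t x := act u t x
  one_smul x := act_one u x
  mul_smul a b x := act_mul u a b x
  smul_zero a := map_zero (act u a)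
  smul_add a x y := map_add (act u a) x y
  add_smul a b x := congrArg (fun f : X →+ X => f x) (map_add (act u) a b)
  zero_smul x := congrArg (fun f : X →+ X => f x) (map_zero (act u))

end TensorRing

/-- The induced `T_R(M)`-module `Ind(X) = (⨁ᵢ (Mⁱ ⊗_R X), c_X)`. -/
abbrev Ind (X : Type u) [AddCommGroup X] [Module R X] : Type u :=
  TensorRing.ModuleOfPair (indMap R M X)

/-- The functor `M ⊗_R -` preserves cotorsion modules. -/
def PreservesCotorsion : Prop :=
  ∀ (C : Type u) [AddCommGroup C] [Module R C], IsCotorsionModule R C →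
    IsCotorsionModule R (BalTensor R M C)

/-- The complex `M ⊗_R T` is acyclic, for a complex `T` of `T_R(M)`-modules, which are regarded
as `R`-modules through `R → T_R(M)`. -/
def TensorComplexAcyclic (T : CochainComplex (ModuleCat.{u} (TensorRing R M)) ℤ) : Prop :=
  ∀ i : ℤ, Function.Exact
    (BalTensor.lTensor M ((ModuleCat.restrictScalars (TensorRing.incl R M)).map
      (T.d (i - 1) i)).hom)
    (BalTensor.lTensor M ((ModuleCat.restrictScalars (TensorRing.incl R M)).map
      (T.d i (i + 1))).hom)

/-- Compatible bimodules: for every totally acyclic complex `T` of flat-cotorsion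
`T_R(M)`-modules, the complex `M ⊗_R T` is acyclic, and so is `Hom(T, Ind(M ⊗_R F))` for every
flat-cotorsion `R`-module `F`. -/
structure IsCompatible : Prop where
  tensor_acyclic : ∀ T : CochainComplex (ModuleCat.{u} (TensorRing R M)) ℤ,
    IsTotallyAcyclicFC T → TensorComplexAcyclic R M T
  hom_acyclic : ∀ T : CochainComplex (ModuleCat.{u} (TensorRing R M)) ℤ,
    IsTotallyAcyclicFC T → ∀ (F : Type u) [AddCommGroup F] [Module R F], IsFlatCotorsion R F →
      HomComplexAcyclic T (Ind R M (BalTensor R M F))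

end TensorRing

end

/-! Write S = T_R(M), and regard R as an S-module through the augmentation S → R. For an S-module Y
with structure map M ⊗_R Y → Y, the cokernel of that map is R ⊗_S Y. The theorem holds because this
base change carries a totally acyclic complex T over S, with X as kernel in degree 0, to a totally
acyclic complex over R, with Coker u as kernel in degree 0.

The main input is that M ⊗_R Y → Y is injective for flat Y (`structMap_injective_of_flat`): the
positive part of S is, as a right ideal, M ⊗_R S, and tensoring its inclusion into S with Y gives
the structure map. So 0 → M ⊗_R Y → Y → Coker → 0 is exact. The cokernel of a flat-cotorsion
S-module is therefore flat (base change) and cotorsion (a quotient of a cotorsion module by a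
cotorsion submodule), see `isFlatCotorsion_coker`. Acyclicity of T and of M ⊗_R T gives acyclicity
of the complex of cokernels, and the same chases applied to the kernel X give injectivity of u.

For a flat-cotorsion R-module W, Hom_R(Coker T, W) is Hom_S(T, W) with M acting as zero on W, and
there is an exact sequence 0 → Ind(M ⊗_R W) → Ind(W) → W → 0. Its first term is cotorsion, by
nilpotency and an induction along sequences of this same kind, so it stays exact under Hom_S(Tⁱ, -).
The complexes Hom_S(T, Ind(W)) and Hom_S(T, Ind(M ⊗_R W)) are acyclic, the former by total
acyclicity and the latter by compatibility, hence so is the third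
(`homComplexAcyclic_cokerComplex`).

Tor is never used. Flatness is expressed by lifting maps into character modules, and cotorsion by
extending maps along monomorphisms with flat cokernel, so that both can be moved between R and S by
adjunction. -/

noncomputable section

/-! ### Character duals -/

/-- The character module of an abelian group underlying a right module. -/
def LeftDual (A : Type u) [AddCommGroup A] : Type u := A →+ AddCircle (1 : ℚ)

/-- The character module of an abelian group underlying a left module. -/
def RightDual (A : Type u) [AddCommGroup A] : Type u := A →+ AddCircle (1 : ℚ)

namespace LeftDual

variable {A : Type u} [AddCommGroup A]

instance : AddCommGroup (LeftDual A) :=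
  inferInstanceAs (AddCommGroup (A →+ AddCircle (1 : ℚ)))

instance : FunLike (LeftDual A) A (AddCircle (1 : ℚ)) where
  coe f := f.toFun
  coe_injective := DFunLike.coe_injective (F := A →+ AddCircle (1 : ℚ))

instance : AddMonoidHomClass (LeftDual A) A (AddCircle (1 : ℚ)) where
  map_add f := f.map_add'
  map_zero f := f.map_zero'

@[ext] lemma ext {f g : LeftDual A} (h : ∀ a, f a = g a) : f = g := DFunLike.ext _ _ h

/-- A character, as an additive map. -/
def toHom : LeftDual A →+ A →+ AddCircle (1 : ℚ) := AddMonoidHom.id _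

@[simp] lemma add_apply (f g : LeftDual A) (a : A) : (f + g) a = f a + g a := rfl

variable {R : Type u} [Ring R] [Module Rᵐᵒᵖ A]

/-- The character module of a right module is a left module through `(r • f) a = f (a · r)`. -/
instance : Module R (LeftDual A) where
  smul r f := f.comp (DistribSMul.toAddMonoidHom A (MulOpposite.op r))
  smul_zero _ := rfl
  smul_add _ _ _ := rfl
  one_smul f := ext fun a => congrArg f (one_smul Rᵐᵒᵖ a)
  mul_smul r s f := ext fun a => congrArg f (mul_smul (MulOpposite.op s) (MulOpposite.op r) a)
  add_smul r s f := ext fun a =>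
    (congrArg f (add_smul (MulOpposite.op r) (MulOpposite.op s) a)).trans (map_add f _ _)
  zero_smul f := ext fun a => (congrArg f (zero_smul Rᵐᵒᵖ a)).trans (map_zero f)

@[simp] lemma smul_apply (r : R) (f : LeftDual A) (a : A) :
    (r • f) a = f (MulOpposite.op r • a) := rfl

/-- Precomposition with a homomorphism of right modules. -/
def map {B : Type u} [AddCommGroup B] [Module Rᵐᵒᵖ B] (f : A →ₗ[Rᵐᵒᵖ] B) :
    LeftDual B →ₗ[R] LeftDual A where
  toFun φ := AddMonoidHom.comp φ f.toAddMonoidHom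
  map_add' _ _ := rfl
  map_smul' r φ := ext fun a => congrArg φ (f.map_smul (MulOpposite.op r) a).symm

end LeftDual

namespace RightDual

variable {A : Type u} [AddCommGroup A]

instance : AddCommGroup (RightDual A) :=
  inferInstanceAs (AddCommGroup (A →+ AddCircle (1 : ℚ)))

instance : FunLike (RightDual A) A (AddCircle (1 : ℚ)) where
  coe f := f.toFun
  coe_injective := DFunLike.coe_injective (F := A →+ AddCircle (1 : ℚ))

instance : AddMonoidHomClass (RightDual A) A (AddCircle (1 : ℚ)) where
  map_add f := f.map_add'
  map_zero f := f.map_zero'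

@[ext] lemma ext {f g : RightDual A} (h : ∀ a, f a = g a) : f = g := DFunLike.ext _ _ h

/-- A character, as an additive map. -/
def toHom : RightDual A →+ A →+ AddCircle (1 : ℚ) := AddMonoidHom.id _

variable {R : Type u} [Ring R] [Module R A]

/-- The character module of a left module is a right module through `(f · r) a = f (r • a)`. -/
instance : Module Rᵐᵒᵖ (RightDual A) where
  smul r f := f.comp (DistribSMul.toAddMonoidHom A r.unop)
  smul_zero _ := rfl
  smul_add _ _ _ := rfl
  one_smul f := ext fun a => congrArg f (one_smul R a)
  mul_smul r s f := ext fun a => congrArg f (mul_smul s.unop r.unop a)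
  add_smul r s f := ext fun a =>
    (congrArg f (add_smul r.unop s.unop a)).trans (map_add f _ _)
  zero_smul f := ext fun a => (congrArg f (zero_smul R a)).trans (map_zero f)

/-- Precomposition with a homomorphism of left modules. -/
def map {B : Type u} [AddCommGroup B] [Module R B] (f : A →ₗ[R] B) :
    RightDual B →ₗ[Rᵐᵒᵖ] RightDual A where
  toFun φ := AddMonoidHom.comp φ f.toAddMonoidHom
  map_add' _ _ := rfl
  map_smul' r φ := ext fun a => congrArg φ (f.map_smul r.unop a).symm

end RightDual

/-- An additive map is injective if and only if all characters extend along it. -/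
lemma injective_iff_forall_character {A B : Type u} [AddCommGroup A] [AddCommGroup B]
    (f : A →+ B) : Function.Injective f ↔
      ∀ χ : A →+ AddCircle (1 : ℚ), ∃ ψ : B →+ AddCircle (1 : ℚ), ∀ a, ψ (f a) = χ a := by
  have h := CharacterModule.dual_surjective_iff_injective (f := f.toIntLinearMap)
  rw [show Function.Injective f ↔ Function.Injective f.toIntLinearMap from Iff.rfl, ← h]
  exact forall_congr' fun χ => exists_congr fun ψ => DFunLike.ext_iff (F := A →+ AddCircle (1 : ℚ))

lemma character_extends {A B : Type u} [AddCommGroup A] [AddCommGroup B]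
    (f : A →+ B) (hf : Function.Injective f) (χ : A →+ AddCircle (1 : ℚ)) :
    ∃ ψ : B →+ AddCircle (1 : ℚ), ∀ a, ψ (f a) = χ a :=
  (injective_iff_forall_character f).1 hf χ

lemma eq_zero_of_forall_character {A : Type u} [AddCommGroup A] {a : A}
    (h : ∀ χ : A →+ AddCircle (1 : ℚ), χ a = 0) : a = 0 :=
  CharacterModule.eq_zero_of_character_apply h

/-! ### Flatness by means of character modules -/

section Flat

variable {R : Type u} [Ring R]

lemma LeftDual.map_surjective {A B : Type u} [AddCommGroup A] [AddCommGroup B] [Module Rᵐᵒᵖ A]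
    [Module Rᵐᵒᵖ B] {f : A →ₗ[Rᵐᵒᵖ] B} (hf : Function.Injective f) :
    Function.Surjective (LeftDual.map f) := fun χ => by
  obtain ⟨ψ, hψ⟩ := character_extends f.toAddMonoidHom hf χ
  exact ⟨ψ, LeftDual.ext hψ⟩

lemma RightDual.map_surjective {A B : Type u} [AddCommGroup A] [AddCommGroup B] [Module R A]
    [Module R B] {f : A →ₗ[R] B} (hf : Function.Injective f) :
    Function.Surjective (RightDual.map f) := fun χ => by
  obtain ⟨ψ, hψ⟩ := character_extends f.toAddMonoidHom hf χ
  exact ⟨ψ, RightDual.ext hψ⟩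

lemma RightDual.map_injective {A B : Type u} [AddCommGroup A] [AddCommGroup B] [Module R A]
    [Module R B] {f : A →ₗ[R] B} (hf : Function.Surjective f) :
    Function.Injective (RightDual.map f) := fun χ ψ h => by
  ext b
  obtain ⟨a, rfl⟩ := hf b
  exact DFunLike.congr_fun h a

lemma BalTensor.addHom_ext {A X : Type u} [AddCommGroup A] [Module Rᵐᵒᵖ A] [AddCommGroup X]
    [Module R X] {P : Type*} [AddCommGroup P] {f g : BalTensor R A X →+ P}
    (h : ∀ a x, f (tmul R a x) = g (tmul R a x)) : f = g := by
  ext t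
  induction t using BalTensor.induction_on with
  | zero => rw [map_zero, map_zero]
  | tmul a x => exact h a x
  | add s t hs ht => rw [map_add, map_add, hs, ht]

/-- Homomorphisms from `F` to the character module of `A` are characters of `A ⊗_R F`. -/
def dualHomEquiv (A F : Type u) [AddCommGroup A] [Module Rᵐᵒᵖ A] [AddCommGroup F] [Module R F] :
    (F →ₗ[R] LeftDual A) ≃ (BalTensor R A F →+ AddCircle (1 : ℚ)) where
  toFun h := QuotientAddGroup.lift (balRel R A F)
    (TensorProduct.liftAddHom (LeftDual.toHom.comp h.toAddMonoidHom).flip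
      (fun n a x => by simp)) (by
        unfold balRel
        rw [AddSubgroup.closure_le]
        rintro _ ⟨a, r, x, rfl⟩
        simp only [SetLike.mem_coe, AddMonoidHom.mem_ker, map_sub, TensorProduct.liftAddHom_tmul]
        change h x (MulOpposite.op r • a) - h (r • x) a = 0
        simp)
  invFun χ :=
    { toFun := fun x => χ.comp ((BalTensor.mk R A F).flip x)
      map_add' := fun x y => LeftDual.ext fun a =>
        (congrArg χ (BalTensor.tmul_add R a x y)).trans (map_add χ _ _)
      map_smul' := fun r x => LeftDual.ext fun a =>
        congrArg χ (BalTensor.op_smul_tmul R r a x).symm }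
  left_inv h := rfl
  right_inv χ := BalTensor.addHom_ext fun _ _ => rfl

/-- A module `F` is flat if and only if `Hom(F, B⁺) → Hom(F, A⁺)` is surjective for every injective
homomorphism `A → B` of right modules. -/
lemma isFlatModule_iff (F : Type u) [AddCommGroup F] [Module R F] :
    IsFlatModule R F ↔ ∀ (A B : Type u) [AddCommGroup A] [AddCommGroup B] [Module Rᵐᵒᵖ A]
      [Module Rᵐᵒᵖ B] (f : A →ₗ[Rᵐᵒᵖ] B), Function.Injective f → ∀ h : F →ₗ[R] LeftDual A,
      ∃ h' : F →ₗ[R] LeftDual B, LeftDual.map f ∘ₗ h' = h := by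
  refine forall_congr' fun A => forall_congr' fun B => forall_congr' fun _ => forall_congr' fun _ =>
    forall_congr' fun _ => forall_congr' fun _ => forall_congr' fun f => forall_congr' fun _ => ?_
  -- Injectivity of A ⊗ F → B ⊗ F is tested on characters, and by adjunction the characters of A ⊗ F
  -- are the homomorphisms F → A⁺.
  rw [injective_iff_forall_character, ← (dualHomEquiv A F).forall_congr_right]
  refine forall_congr' fun h => ?_
  rw [← (dualHomEquiv B F).exists_congr_right]
  refine exists_congr fun h' => ⟨fun H => ?_, fun H t => ?_⟩
  · ext x a
    exact H (BalTensor.tmul R a x)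
  · exact DFunLike.congr_fun (BalTensor.addHom_ext
      (f := (dualHomEquiv B F h').comp (BalTensor.rTensor F f)) (g := dualHomEquiv A F h)
      fun a x => DFunLike.congr_fun (LinearMap.congr_fun H x) a) t

/-- The correspondence between homomorphisms `F → A⁺` and `A → F⁺`. -/
def dualFlip (A F : Type u) [AddCommGroup A] [Module Rᵐᵒᵖ A] [AddCommGroup F] [Module R F] :
    (F →ₗ[R] LeftDual A) ≃ (A →ₗ[Rᵐᵒᵖ] RightDual F) where
  toFun h :=
    { toFun := fun a => (LeftDual.toHom.comp h.toAddMonoidHom).flip a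
      map_add' := fun a b => map_add ((LeftDual.toHom.comp h.toAddMonoidHom).flip) a b
      map_smul' := fun r a => RightDual.ext fun x =>
        (DFunLike.congr_fun (h.map_smul r.unop x) a).symm }
  invFun h :=
    { toFun := fun a => (RightDual.toHom.comp h.toAddMonoidHom).flip a
      map_add' := fun a b => map_add ((RightDual.toHom.comp h.toAddMonoidHom).flip) a b
      map_smul' := fun r a => LeftDual.ext fun x =>
        (DFunLike.congr_fun (h.map_smul (MulOpposite.op r) x) a).symm }
  left_inv _ := rfl
  right_inv _ := rfl

/-- A homomorphism on `P` which vanishes on the image of `K` factors through the cokernel. -/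
lemma exists_factor_of_exact {S : Type*} [Ring S] {K P G D : Type*} [AddCommGroup K]
    [AddCommGroup P] [AddCommGroup G] [AddCommGroup D] [Module S K] [Module S P] [Module S G]
    [Module S D] {i : K →ₗ[S] P} {p : P →ₗ[S] G} (hp : Function.Surjective p)
    (hip : Function.Exact i p) (f : P →ₗ[S] D) (hf : f ∘ₗ i = 0) :
    ∃ g : G →ₗ[S] D, g ∘ₗ p = f := by
  have hker : LinearMap.ker p ≤ LinearMap.ker f := fun x hx => by
    obtain ⟨k, rfl⟩ := (hip x).1 hx
    exact LinearMap.congr_fun hf k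
  refine ⟨(LinearMap.ker p).liftQ f hker ∘ₗ (p.quotKerEquivOfSurjective hp).symm.toLinearMap, ?_⟩
  ext x
  have : (p.quotKerEquivOfSurjective hp).symm (p x) = Submodule.Quotient.mk x :=
    (LinearEquiv.symm_apply_eq _).2 rfl
  simp [this]

/-- A homomorphism to `P` with image in the kernel of `p` factors through the kernel. -/
lemma exists_lift_of_exact {S : Type*} [Ring S] {K P G D : Type*} [AddCommGroup K]
    [AddCommGroup P] [AddCommGroup G] [AddCommGroup D] [Module S K] [Module S P] [Module S G]
    [Module S D] {i : K →ₗ[S] P} {p : P →ₗ[S] G} (hi : Function.Injective i)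
    (hip : Function.Exact i p) (f : D →ₗ[S] P) (hf : p ∘ₗ f = 0) :
    ∃ g : D →ₗ[S] K, i ∘ₗ g = f := by
  have hr : ∀ d, f d ∈ LinearMap.range i := fun d => (hip (f d)).1 (LinearMap.congr_fun hf d)
  refine ⟨(LinearEquiv.ofInjective i hi).symm.toLinearMap ∘ₗ f.codRestrict _ hr, ?_⟩
  ext d
  exact congrArg Subtype.val
    ((LinearEquiv.ofInjective i hi).apply_symm_apply (f.codRestrict _ hr d))

variable {K P G : Type u} [AddCommGroup K] [AddCommGroup P] [AddCommGroup G] [Module R K]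
  [Module R P] [Module R G] {i : K →ₗ[R] P} {p : P →ₗ[R] G}

/-- A short exact sequence with flat cokernel is pure: maps to character modules extend. -/
lemma IsFlatModule.exists_extension_leftDual (hG : IsFlatModule R G) (hi : Function.Injective i)
    (hp : Function.Surjective p) (hip : Function.Exact i p) {A : Type u} [AddCommGroup A]
    [Module Rᵐᵒᵖ A] (h : K →ₗ[R] LeftDual A) : ∃ h' : P →ₗ[R] LeftDual A, h' ∘ₗ i = h := by
  -- Dualising gives a short exact sequence G⁺ → P⁺ → K⁺ of right modules, which the flatness of G
  -- will split.
  have hexact : Function.Exact (RightDual.map p) (RightDual.map i) := by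
    intro φ
    constructor
    · intro hφ
      have hker : ∀ x, p x = 0 → φ x = 0 := fun x hx => by
        obtain ⟨k, rfl⟩ := (hip x).1 hx
        exact DFunLike.congr_fun hφ k
      let e := QuotientAddGroup.quotientKerEquivOfSurjective p.toAddMonoidHom hp
      refine ⟨(QuotientAddGroup.lift p.toAddMonoidHom.ker φ hker).comp e.symm.toAddMonoidHom, ?_⟩
      ext x
      have : e.symm (p x) = QuotientAddGroup.mk x := e.symm_apply_eq.2 rfl
      change QuotientAddGroup.lift p.toAddMonoidHom.ker φ hker (e.symm (p x)) = φ x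
      rw [this]
      rfl
    · rintro ⟨ψ, rfl⟩
      ext k
      exact (congrArg ψ (hip.apply_apply_eq_zero k)).trans (map_zero ψ)
  -- Flatness of G makes G⁺ injective: the flatness criterion for the inclusion G⁺ → P⁺, applied to
  -- the evaluation map G → G⁺⁺, yields a retraction P⁺ → G⁺.
  obtain ⟨ρ, hρ⟩ := (isFlatModule_iff G).1 hG _ _ (RightDual.map p) (RightDual.map_injective hp)
    ((dualFlip _ _).symm LinearMap.id)
  have hretr : dualFlip _ _ ρ ∘ₗ RightDual.map p = LinearMap.id := by
    ext ψ x
    exact DFunLike.congr_fun (LinearMap.congr_fun hρ x) ψ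
  -- The retraction is traded for a section σ of P⁺ → K⁺. A map K → A⁺ is a map A → K⁺, and
  -- composing the latter with σ gives the extension to P.
  obtain ⟨-, σ, hσ⟩ := (hexact.split_tfae'.out 1 0 :
    (Function.Surjective (RightDual.map i) ∧ ∃ l, l ∘ₗ RightDual.map p = LinearMap.id) ↔
    (Function.Injective (RightDual.map p) ∧ ∃ l, RightDual.map i ∘ₗ l = LinearMap.id)).1
    ⟨RightDual.map_surjective hi, _, hretr⟩
  refine ⟨(dualFlip _ _).symm (σ ∘ₗ dualFlip _ _ h), ?_⟩
  ext k a
  exact DFunLike.congr_fun (LinearMap.congr_fun hσ (dualFlip _ _ h a)) k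

lemma isFlatModule_of_projective [Module.Projective R P] : IsFlatModule R P :=
  (isFlatModule_iff P).2 fun _ _ _ _ _ _ f hf h =>
    Module.projective_lifting_property (LeftDual.map f) h (LeftDual.map_surjective hf)

/-- The kernel of a projection from a flat module to a flat module is flat. -/
lemma IsFlatModule.of_exact (hP : IsFlatModule R P) (hG : IsFlatModule R G)
    (hi : Function.Injective i) (hp : Function.Surjective p) (hip : Function.Exact i p) :
    IsFlatModule R K :=
  (isFlatModule_iff K).2 fun A B _ _ _ _ f hf h => by
    obtain ⟨h₁, rfl⟩ := hG.exists_extension_leftDual hi hp hip h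
    obtain ⟨h₂, rfl⟩ := (isFlatModule_iff P).1 hP A B f hf h₁
    exact ⟨h₂ ∘ₗ i, rfl⟩

end Flat

/-! ### Cotorsion modules: extension and lifting of homomorphisms -/

section Cotorsion

variable {S : Type u} [Ring S]

lemma shortExact_of_exact {K P G : Type u} [AddCommGroup K] [AddCommGroup P] [AddCommGroup G]
    [Module S K] [Module S P] [Module S G] {i : K →ₗ[S] P} {p : P →ₗ[S] G}
    (hi : Function.Injective i) (hp : Function.Surjective p) (hip : Function.Exact i p) :
    (ShortComplex.mk (ModuleCat.ofHom i) (ModuleCat.ofHom p)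
      (by ext x; exact hip.apply_apply_eq_zero x)).ShortExact where
  exact := (ShortComplex.ShortExact.moduleCat_exact_iff_function_exact _).2 hip
  mono_f := (ModuleCat.mono_iff_injective _).2 hi
  epi_g := (ModuleCat.epi_iff_surjective _).2 hp

variable {C : Type u} [AddCommGroup C] [Module S C]

/-- Maps to a cotorsion module extend along monomorphisms with flat cokernel. -/
lemma IsCotorsionModule.exists_extension (hC : IsCotorsionModule S C) {K P G : Type u}
    [AddCommGroup K] [AddCommGroup P] [AddCommGroup G] [Module S K] [Module S P] [Module S G]
    {i : K →ₗ[S] P} {p : P →ₗ[S] G} (hG : IsFlatModule S G)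
    (hi : Function.Injective i) (hp : Function.Surjective p) (hip : Function.Exact i p)
    (f : K →ₗ[S] C) : ∃ g : P →ₗ[S] C, g ∘ₗ i = f := by
  have := hC G hG
  -- The obstruction to extending f is its image under the connecting map, which lies in the
  -- vanishing group Ext¹(G, C).
  obtain ⟨x, hx⟩ := Abelian.Ext.contravariant_sequence_exact₁ (shortExact_of_exact hi hp hip)
    (ModuleCat.of S C) (Abelian.Ext.mk₀ (ModuleCat.ofHom f)) (add_zero 1)
    (Subsingleton.elim _ _)
  obtain ⟨g, rfl⟩ := Abelian.Ext.addEquiv₀.symm.surjective x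
  refine ⟨g.hom, ?_⟩
  have h := Abelian.Ext.addEquiv₀.symm.injective
    ((Abelian.Ext.mk₀_comp_mk₀ _ _).symm.trans hx)
  exact congrArg ModuleCat.Hom.hom h

/-- Since Ext¹(P, C) = 0, each class in Ext¹(G, C) is the image of some f : K → C under the
connecting map. If f extends to P, the class contains the composite of the extension class with i,
which is zero. -/
lemma ext_one_subsingleton_of_forall_extension {K P G : Type u} [AddCommGroup K]
    [AddCommGroup P] [AddCommGroup G] [Module S K] [Module S P] [Module S G]
    [Module.Projective S P] {i : K →ₗ[S] P} {p : P →ₗ[S] G} (hi : Function.Injective i)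
    (hp : Function.Surjective p) (hip : Function.Exact i p)
    (h : ∀ f : K →ₗ[S] C, ∃ g : P →ₗ[S] C, g ∘ₗ i = f) :
    Subsingleton (Abelian.Ext.{u} (ModuleCat.of S G) (ModuleCat.of S C) 1) := by
  have hs := shortExact_of_exact hi hp hip
  refine subsingleton_of_forall_eq 0 fun e => ?_
  have : Projective (ModuleCat.of S P) := (IsProjective.iff_projective (R := S) P).1 inferInstance
  obtain ⟨x, rfl⟩ := Abelian.Ext.contravariant_sequence_exact₃ hs
    (ModuleCat.of S C) e (Abelian.Ext.eq_zero_of_projective _) (add_zero 1)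
  obtain ⟨f, rfl⟩ := Abelian.Ext.addEquiv₀.symm.surjective x
  obtain ⟨g, hg⟩ := h f.hom
  have hf : f = ModuleCat.ofHom i ≫ ModuleCat.ofHom g :=
    ModuleCat.hom_ext hg.symm
  subst hf
  change hs.extClass.comp (Abelian.Ext.mk₀ _) _ = 0
  rw [← Abelian.Ext.mk₀_comp_mk₀]
  exact hs.extClass_comp_assoc _

/-- A module is cotorsion if maps to it extend along the inclusion of the kernel of every
surjection from a projective module to a flat module. -/
lemma isCotorsionModule_of_forall_extension
    (h : ∀ (K P G : Type u) [AddCommGroup K] [AddCommGroup P] [AddCommGroup G] [Module S K]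
      [Module S P] [Module S G] [Module.Projective S P] (i : K →ₗ[S] P) (p : P →ₗ[S] G),
      IsFlatModule S G → Function.Injective i → Function.Surjective p → Function.Exact i p →
      ∀ f : K →ₗ[S] C, ∃ g : P →ₗ[S] C, g ∘ₗ i = f) : IsCotorsionModule S C := by
  intro F _ _ hF
  let p : (F →₀ S) →ₗ[S] F := Finsupp.linearCombination S id
  have hp : Function.Surjective p := Finsupp.linearCombination_id_surjective S F
  have hi : Function.Injective (LinearMap.ker p).subtype := Subtype.val_injective
  have hip : Function.Exact (LinearMap.ker p).subtype p := p.exact_subtype_ker_map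
  exact ext_one_subsingleton_of_forall_extension (K := LinearMap.ker p) (P := F →₀ S) (G := F)
    hi hp hip (h (LinearMap.ker p) (F →₀ S) F (LinearMap.ker p).subtype p hF hi hp hip)

variable {E Q : Type u} [AddCommGroup E] [AddCommGroup Q] [Module S E] [Module S Q]
  {j : C →ₗ[S] E} {q : E →ₗ[S] Q}

/-- Maps from a flat module lift along epimorphisms with cotorsion kernel. -/
lemma IsCotorsionModule.exists_lift (hC : IsCotorsionModule S C) (hj : Function.Injective j)
    (hq : Function.Surjective q) (hjq : Function.Exact j q) {G : Type u} [AddCommGroup G]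
    [Module S G] (hG : IsFlatModule S G) (f : G →ₗ[S] Q) : ∃ g : G →ₗ[S] E, q ∘ₗ g = f := by
  have := hC G hG
  obtain ⟨x, hx⟩ := Abelian.Ext.covariant_sequence_exact₃ (ModuleCat.of S G)
    (shortExact_of_exact hj hq hjq) (Abelian.Ext.mk₀ (ModuleCat.ofHom f)) (zero_add 1)
    (Subsingleton.elim _ _)
  obtain ⟨g, rfl⟩ := Abelian.Ext.addEquiv₀.symm.surjective x
  refine ⟨g.hom, ?_⟩
  have h := Abelian.Ext.addEquiv₀.symm.injective
    ((Abelian.Ext.mk₀_comp_mk₀ _ _).symm.trans hx)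
  exact congrArg ModuleCat.Hom.hom h

/-- Cotorsion modules are closed under extensions. -/
lemma IsCotorsionModule.of_extension (hC : IsCotorsionModule S C) (hQ : IsCotorsionModule S Q)
    (hj : Function.Injective j) (hq : Function.Surjective q) (hjq : Function.Exact j q) :
    IsCotorsionModule S E := by
  intro F _ _ hF
  have := hC F hF
  have := hQ F hF
  refine subsingleton_of_forall_eq 0 fun e => ?_
  obtain ⟨x, rfl⟩ := Abelian.Ext.covariant_sequence_exact₂ (ModuleCat.of S F)
    (shortExact_of_exact hj hq hjq) e (Subsingleton.elim _ _)
  rw [Subsingleton.elim x 0, Abelian.Ext.zero_comp]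

/-- The quotient of a cotorsion module by a cotorsion submodule is cotorsion. -/
lemma IsCotorsionModule.of_exact (hC : IsCotorsionModule S C) (hE : IsCotorsionModule S E)
    (hj : Function.Injective j) (hq : Function.Surjective q) (hjq : Function.Exact j q) :
    IsCotorsionModule S Q :=
  isCotorsionModule_of_forall_extension fun K P G _ _ _ _ _ _ _ i p hG hi hp hip f => by
    -- Flatness of the syzygy K replaces the vanishing of Ext²(G, C): a map K → Q lifts to E because
    -- C is cotorsion, extends to P because E is cotorsion, and is then projected back to Q.
    have hK : IsFlatModule S K := isFlatModule_of_projective.of_exact hG hi hp hip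
    obtain ⟨g, rfl⟩ := hC.exists_lift hj hq hjq hK f
    obtain ⟨g', rfl⟩ := hE.exists_extension hG hi hp hip g
    exact ⟨q ∘ₗ g', rfl⟩

lemma isCotorsionModule_of_subsingleton [Subsingleton C] : IsCotorsionModule S C :=
  isCotorsionModule_of_forall_extension fun _ _ _ _ _ _ _ _ _ _ _ _ _ _ _ _ _ =>
    ⟨0, LinearMap.ext fun _ => Subsingleton.elim _ _⟩

end Cotorsion

/-! ### Functoriality and right exactness of the tensor product -/

namespace BalTensor

variable {R : Type u} [Ring R] {M : Type u} [AddCommGroup M] [Module Rᵐᵒᵖ M]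
variable {X Y Z : Type u} [AddCommGroup X] [Module R X] [AddCommGroup Y] [Module R Y]
  [AddCommGroup Z] [Module R Z]

lemma lTensor_comp_apply (g : Y →ₗ[R] Z) (f : X →ₗ[R] Y) (t : BalTensor R M X) :
    lTensor M g (lTensor M f t) = lTensor M (g ∘ₗ f) t :=
  DFunLike.congr_fun (addHom_ext (f := (lTensor M g).comp (lTensor M f))
    (g := lTensor M (g ∘ₗ f)) fun _ _ => rfl) t

lemma lTensor_zero_apply (t : BalTensor R M X) : lTensor M (0 : X →ₗ[R] Y) t = 0 :=
  DFunLike.congr_fun (addHom_ext (f := lTensor M (0 : X →ₗ[R] Y)) (g := 0)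
    fun m _ => tmul_zero R m) t

lemma lTensor_surjective {f : X →ₗ[R] Y} (hf : Function.Surjective f) :
    Function.Surjective (lTensor M f) := fun t => by
  induction t using BalTensor.induction_on with
  | zero => exact ⟨0, map_zero _⟩
  | tmul m y =>
    obtain ⟨x, rfl⟩ := hf y
    exact ⟨tmul R m x, rfl⟩
  | add s t hs ht =>
    obtain ⟨s, rfl⟩ := hs
    obtain ⟨t, rfl⟩ := ht
    exact ⟨s + t, map_add _ _ _⟩

/-- The functor `M ⊗_R -` is right exact. -/
lemma lTensor_exact {f : X →ₗ[R] Y} {g : Y →ₗ[R] Z} (hg : Function.Surjective g)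
    (hfg : Function.Exact f g) : Function.Exact (lTensor M f) (lTensor M g) := by
  intro t
  constructor
  · intro ht
    change t ∈ (lTensor M f).range
    rw [← QuotientAddGroup.eq_zero_iff]
    refine eq_zero_of_forall_character fun χ => ?_
    -- A character of the cokernel of M ⊗ f is a homomorphism Y → M⁺ that vanishes on the image of
    -- f, so it factors through Z. Its value at t then depends only on the image of t in M ⊗ Z,
    -- which is zero.
    let φ := (dualHomEquiv (R := R) M Y).symm (χ.comp (QuotientAddGroup.mk' (lTensor M f).range))
    obtain ⟨ψ, hψ⟩ := exists_factor_of_exact hg hfg φ (by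
      ext x m
      change χ (QuotientAddGroup.mk (lTensor M f (tmul R m x))) = 0
      rw [(QuotientAddGroup.eq_zero_iff (lTensor M f (tmul R m x))).2 (AddMonoidHom.mem_range.2
        ⟨_, rfl⟩), map_zero])
    have key : (dualHomEquiv (R := R) M Z ψ).comp (lTensor M g) =
        χ.comp (QuotientAddGroup.mk' (lTensor M f).range) := addHom_ext fun m y =>
      DFunLike.congr_fun (LinearMap.congr_fun hψ y) m
    have := DFunLike.congr_fun key t
    rw [AddMonoidHom.comp_apply, ht, map_zero] at this
    exact this.symm
  · rintro ⟨s, rfl⟩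
    rw [lTensor_comp_apply, hfg.linearMap_comp_eq_zero, lTensor_zero_apply]

end BalTensor

section TensorMaps

variable {R : Type u} [Ring R] {M : Type u} [AddCommGroup M] [Module R M] [Module Rᵐᵒᵖ M]
  [SMulCommClass R Rᵐᵒᵖ M]
variable {X Y Z : Type u} [AddCommGroup X] [Module R X] [AddCommGroup Y] [Module R Y]

namespace BalTensor

variable (M) in
/-- The `R`-linear map `M ⊗ f : M ⊗_R X → M ⊗_R Y` for an `R`-bimodule `M`. -/
def lTensorLin (f : X →ₗ[R] Y) : BalTensor R M X →ₗ[R] BalTensor R M Y :=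
  { lTensor M f with
    map_smul' := fun r t => by
      induction t using BalTensor.induction_on with
      | zero => simp
      | tmul m x => rfl
      | add s t hs ht =>
        simp only [smul_add, ZeroHom.toFun_eq_coe, AddMonoidHom.toZeroHom_coe, map_add] at hs ht ⊢
        rw [hs, ht] }

@[simp]
lemma lTensorLin_tmul (f : X →ₗ[R] Y) (m : M) (x : X) :
    lTensorLin M f (tmul R m x) = tmul R m (f x) := rfl

lemma linearMap_ext {f g : BalTensor R M X →ₗ[R] Y}
    (h : ∀ m x, f (tmul R m x) = g (tmul R m x)) : f = g :=
  LinearMap.toAddMonoidHom_injective (addHom_ext h)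

variable (M) in
/-- The isomorphism `M ⊗_R X ≃ M ⊗_R Y` induced by an isomorphism `X ≃ Y`. -/
def lTensorEquiv (e : X ≃ₗ[R] Y) : BalTensor R M X ≃ₗ[R] BalTensor R M Y :=
  LinearEquiv.ofLinearMap (lTensorLin M e.toLinearMap) (lTensorLin M e.symm.toLinearMap)
    (linearMap_ext fun m x => by simp) (linearMap_ext fun m x => by simp)

end BalTensor

/-! ### Tensor powers and nilpotency -/

section Tpow

/-- The map `Mⁱ ⊗_R V → Mⁱ ⊗_R W` induced by a homomorphism `V → W`. -/
def tpowMap {V W : ModuleCat.{u} R} (f : V →ₗ[R] W) :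
    (i : ℕ) → tpowTensor R M V i →ₗ[R] tpowTensor R M W i
  | 0 => (tpowZero R M W).toLinearMap ∘ₗ f ∘ₗ (tpowZero R M V).symm.toLinearMap
  | i + 1 => (tpowSucc R M W i).toLinearMap ∘ₗ BalTensor.lTensorLin M (tpowMap f i) ∘ₗ
      (tpowSucc R M V i).symm.toLinearMap

/-- Nilpotency concerns Mⁱ = Mⁱ ⊗ R only. An elementary tensor m₁ ⊗ … ⊗ mᵢ ⊗ x is the image of m₁ ⊗
… ⊗ mᵢ ⊗ 1 under the map induced by R → W, 1 ↦ x. This transfers vanishing to Mⁱ ⊗ W without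
associativity of the tensor product. -/
lemma mem_closure_range_tpowMap (W : ModuleCat.{u} R) (i : ℕ) (y : tpowTensor R M W i) :
    y ∈ AddSubgroup.closure {z | ∃ (x : W) (t : tpow R M i),
      z = tpowMap (V := ModuleCat.of R R) (LinearMap.toSpanSingleton R W x) i t} := by
  induction i with
  | zero =>
    refine AddSubgroup.subset_closure
      ⟨(tpowZero R M W).symm y, tpowZero R M (ModuleCat.of R R) (1 : R), ?_⟩
    exact (one_smul R ((tpowZero R M W).symm y)).symm
  | succ i ih =>
    obtain ⟨z, rfl⟩ := (tpowSucc R M W i).surjective y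
    induction z using BalTensor.induction_on with
    | zero => rw [map_zero]; exact zero_mem _
    | add s t hs ht => rw [map_add]; exact add_mem hs ht
    | tmul m y =>
      induction ih y using AddSubgroup.closure_induction with
      | mem z hz =>
        obtain ⟨x, t, rfl⟩ := hz
        exact AddSubgroup.subset_closure
          ⟨x, tpowSucc R M (ModuleCat.of R R) i (BalTensor.tmul R m t), rfl⟩
      | zero => rw [BalTensor.tmul_zero, map_zero]; exact zero_mem _
      | add s t _ _ hs ht => rw [BalTensor.tmul_add, map_add]; exact add_mem hs ht
      | neg s _ hs =>
        have : BalTensor.tmul R m (-s) = -BalTensor.tmul R m s :=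
          map_neg (BalTensor.mk R M _ m) s
        rw [this, map_neg]
        exact neg_mem hs

lemma IsNilpotentBimodule.subsingleton_tpowTensor {N : ℕ} (hN : IsNilpotentBimodule R M N)
    (W : ModuleCat.{u} R) : Subsingleton (tpowTensor R M W (N + 1)) := by
  have : Subsingleton (tpow R M (N + 1)) := hN
  refine subsingleton_of_forall_eq 0 fun y => ?_
  have hy := mem_closure_range_tpowMap W (N + 1) y
  rw [← AddSubgroup.mem_bot]
  refine (AddSubgroup.closure_le _).2 ?_ hy
  rintro _ ⟨x, t, rfl⟩
  rw [Subsingleton.elim t 0, map_zero]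
  exact zero_mem _

variable (R M) in
/-- The identification `Mⁱ ⊗_R (M ⊗_R W) = Mⁱ⁺¹ ⊗_R W`. -/
def tpowTensorShift (W : Type u) [AddCommGroup W] [Module R W] :
    (i : ℕ) → tpowTensor R M (ModuleCat.of R (BalTensor R M W)) i ≃ₗ[R]
      tpowTensor R M (ModuleCat.of R W) (i + 1)
  | 0 => (tpowZero R M (ModuleCat.of R (BalTensor R M W))).symm ≪≫ₗ
      tpowSucc R M (ModuleCat.of R W) 0
  | i + 1 => (tpowSucc R M (ModuleCat.of R (BalTensor R M W)) i).symm ≪≫ₗ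
      BalTensor.lTensorEquiv M (tpowTensorShift W i) ≪≫ₗ tpowSucc R M (ModuleCat.of R W) (i + 1)

lemma tpowTensorShift_succ_tmul (W : Type u) [AddCommGroup W] [Module R W] (i : ℕ) (m : M)
    (y : tpowTensor R M (ModuleCat.of R (BalTensor R M W)) i) :
    tpowTensorShift R M W (i + 1) (tpowSucc R M _ i (BalTensor.tmul R m y)) =
      tpowSucc R M (ModuleCat.of R W) (i + 1)
        (BalTensor.tmul R m (tpowTensorShift R M W i y)) := rfl

end Tpow

/-- The structure map of an induced module is injective. -/
lemma indMap_injective (W : Type u) [AddCommGroup W] [Module R W] :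
    Function.Injective (indMap R M W) := by
  -- An additive retraction that lowers the degree by one and kills degree zero; no flatness of M or
  -- W is involved.
  let l : IndCarrier R M W →+ BalTensor R M (IndCarrier R M W) :=
    DirectSum.toAddMonoid fun i => match i with
      | 0 => 0
      | i + 1 => (BalTensor.lTensor M (indOf R M W i)).comp
          (tpowSucc R M (ModuleCat.of R W) i).symm.toLinearMap.toAddMonoidHom
  have hl : ∀ (i : ℕ) (z : BalTensor R M (tpowTensor R M (ModuleCat.of R W) i)),
      l (indOf R M W (i + 1) (tpowSucc R M (ModuleCat.of R W) i z)) =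
        BalTensor.lTensor M (indOf R M W i) z := fun i z => DirectSum.toAddMonoid_of _ _ _
  have h : l.comp (indMap R M W).toAddMonoidHom = AddMonoidHom.id _ := by
    refine BalTensor.addHom_ext fun m x => ?_
    refine DFunLike.congr_fun (f := (l.comp (indMap R M W).toAddMonoidHom).comp
      (BalTensor.mk R M _ m)) (g := BalTensor.mk R M _ m) (DirectSum.addHom_ext fun i y => ?_) x
    change l (indMap R M W (BalTensor.tmul R m (indOf R M W i y))) =
      BalTensor.tmul R m (indOf R M W i y)
    rw [indMap_tmul_of, hl]
    rfl
  exact Function.LeftInverse.injective (g := l) (DFunLike.congr_fun h)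

end TensorMaps

/-! ### Modules over the tensor ring -/

namespace TensorRing

variable {R : Type u} [Ring R] {M : Type u} [AddCommGroup M] [Module R M] [Module Rᵐᵒᵖ M]
  [SMulCommClass R Rᵐᵒᵖ M]

/-- The element of degree one of `T_R(M)` given by `m ∈ M`. -/
def gen (R : Type u) [Ring R] {M : Type u} [AddCommGroup M] [Module R M] [Module Rᵐᵒᵖ M]
    [SMulCommClass R Rᵐᵒᵖ M] (m : M) : TensorRing R M := shift R M (BalTensor.tmul R m 1)

lemma shift_tmul (m : M) (t : TensorRing R M) :
    shift R M (BalTensor.tmul R m t) = gen R m * t := by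
  rw [gen, shift_mul, one_mul]

lemma shift_injective : Function.Injective (shift R M) := indMap_injective R

lemma gen_add (m m' : M) : gen R (m + m') = gen R m + gen R m' := by
  rw [gen, BalTensor.add_tmul, map_add]
  rfl

lemma gen_smul (r : R) (m : M) : gen R (r • m) = r • gen R m := by
  rw [gen, ← BalTensor.smul_tmul', map_smul]
  rfl

lemma gen_op_smul (r : R) (m : M) : gen R (MulOpposite.op r • m) = gen R m * scalar R M r := by
  rw [gen, BalTensor.op_smul_tmul, ← shift_tmul, one_def, ← map_smul, smul_eq_mul, mul_one]

/-! ### The structure map of a module and its cokernel -/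

section Modules

variable {X Y Z : Type u} [AddCommGroup X] [Module R X] [Module (TensorRing R M) X]
  [IsScalarTower R (TensorRing R M) X] [AddCommGroup Y] [Module R Y] [Module (TensorRing R M) Y]
  [IsScalarTower R (TensorRing R M) Y] [AddCommGroup Z] [Module R Z]

lemma scalar_smul (r : R) (y : Y) : scalar R M r • y = r • y := by
  have : scalar R M r = r • (1 : TensorRing R M) := by
    rw [one_def, ← map_smul, smul_eq_mul, mul_one]
  rw [this, smul_assoc, one_smul]

variable (R M Y) in
/-- The structure map `M ⊗_R Y → Y` of a `T_R(M)`-module `Y`. -/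
def structMap : BalTensor R M Y →ₗ[R] Y :=
  BalTensor.liftLin
    { toFun := fun m => DistribSMul.toAddMonoidHom Y (gen R m)
      map_add' := fun m m' => by
        ext y
        exact (congrArg (· • y) (gen_add m m')).trans (add_smul _ _ y)
      map_smul' := fun r m => by
        ext y
        exact (congrArg (· • y) (gen_smul r m)).trans (smul_assoc r (gen R m) y) }
    (fun r m y => by
      change gen R (MulOpposite.op r • m) • y = gen R m • r • y
      rw [gen_op_smul, mul_smul, scalar_smul])

/-- Naturality of the structure map; on elementary tensors it is linearity of f over elements of
degree one. All the diagram chases below rely on it. -/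
lemma structMap_lTensor (f : X →ₗ[TensorRing R M] Y) (t : BalTensor R M X) :
    structMap R M Y (BalTensor.lTensor M (f.restrictScalars R) t) = f (structMap R M X t) :=
  DFunLike.congr_fun (BalTensor.addHom_ext
    (f := (structMap R M Y).toAddMonoidHom.comp (BalTensor.lTensor M (f.restrictScalars R)))
    (g := f.toAddMonoidHom.comp (structMap R M X).toAddMonoidHom)
    fun m x => (f.map_smul (gen R m) x).symm) t

/-- An `R`-homomorphism which commutes with the action of `M` is a `T_R(M)`-homomorphism. -/
def linearOfGen (f : X →ₗ[R] Y) (hf : ∀ (m : M) (x : X), f (gen R m • x) = gen R m • f x) :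
    X →ₗ[TensorRing R M] Y where
  toFun := f
  map_add' := f.map_add
  map_smul' t x := by
    rw [RingHom.id_apply]
    induction t using TensorRing.induction_on generalizing x with
    | zero => simp
    | scalar r => rw [scalar_smul, scalar_smul, map_smul]
    | tmul m i y ih => rw [shift_tmul, mul_smul, mul_smul, hf, ih]
    | add s t hs ht => rw [add_smul, map_add, hs, ht, add_smul]

variable (R M Y) in
/-- The cokernel of the structure map of a `T_R(M)`-module. -/
abbrev Coker : Type u := Y ⧸ LinearMap.range (structMap R M Y)

lemma mk_gen_smul (m : M) (y : Y) :
    (LinearMap.range (structMap R M Y)).mkQ (gen R m • y) = 0 :=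
  (Submodule.Quotient.mk_eq_zero _).2 ⟨BalTensor.tmul R m y, rfl⟩

/-- The homomorphism induced on the cokernels of the structure maps. -/
def cokerMap (f : X →ₗ[TensorRing R M] Y) : Coker R M X →ₗ[R] Coker R M Y :=
  Submodule.mapQ _ _ (f.restrictScalars R) (by
    rintro _ ⟨t, rfl⟩
    exact ⟨_, structMap_lTensor f t⟩)

@[simp]
lemma cokerMap_mk (f : X →ₗ[TensorRing R M] Y) (x : X) :
    cokerMap f ((LinearMap.range (structMap R M X)).mkQ x) =
      (LinearMap.range (structMap R M Y)).mkQ (f x) := rfl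

end Modules

/-! ### Pairs and stalk modules -/

section Pairs

variable {X : Type u} [AddCommGroup X] [Module R X] (u : BalTensor R M X →ₗ[R] X)

instance : Module R (ModuleOfPair u) := inferInstanceAs (Module R X)

lemma smul_def (t : TensorRing R M) (x : ModuleOfPair u) : t • x = act u t x := rfl

instance : IsScalarTower R (TensorRing R M) (ModuleOfPair u) where
  smul_assoc r t x := by
    rw [smul_def, map_smul]
    rfl

lemma gen_smul_pair (m : M) (x : ModuleOfPair u) :
    gen R m • x = (u (BalTensor.tmul R m (x : X)) : X) := by
  exact (act_shift u m 1 x).trans (congrArg (fun y => u (BalTensor.tmul R m y)) (act_one u x))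

lemma structMap_pair : structMap R M (ModuleOfPair u) = u :=
  BalTensor.linearMap_ext fun m x => gen_smul_pair u m x

variable (R M) in
/-- An `R`-module on which `M` acts as zero. -/
abbrev Stalk (W : Type u) [AddCommGroup W] [Module R W] : Type u :=
  ModuleOfPair (0 : BalTensor R M W →ₗ[R] W)

lemma gen_smul_stalk {W : Type u} [AddCommGroup W] [Module R W] (m : M) (w : Stalk R M W) :
    gen R m • w = 0 := gen_smul_pair 0 m w

variable (R M) in
/-- The identification of an `R`-module with the associated stalk module. -/
def toStalk (W : Type u) [AddCommGroup W] [Module R W] : W ≃ₗ[R] Stalk R M W :=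
  LinearEquiv.refl R W

variable {Y W : Type u} [AddCommGroup Y] [Module R Y] [Module (TensorRing R M) Y]
  [IsScalarTower R (TensorRing R M) Y] [AddCommGroup W] [Module R W]

/-- Homomorphisms from the cokernel of the structure map to `W` are homomorphisms to the stalk
module of `W`. -/
def stalkHom (f : Coker R M Y →ₗ[R] W) : Y →ₗ[TensorRing R M] Stalk R M W :=
  linearOfGen ((toStalk R M W).toLinearMap ∘ₗ f ∘ₗ (LinearMap.range (structMap R M Y)).mkQ)
    fun m y => by
      rw [gen_smul_stalk, LinearMap.comp_apply, LinearMap.comp_apply, mk_gen_smul, map_zero,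
        map_zero]

/-- The homomorphism from the cokernel induced by a homomorphism to a module with trivial action
of `M`. -/
def cokerDesc (f : Y →ₗ[R] W) (hf : ∀ (m : M) (y : Y), f (gen R m • y) = 0) :
    Coker R M Y →ₗ[R] W :=
  (LinearMap.range (structMap R M Y)).liftQ f (by
    rintro _ ⟨t, rfl⟩
    have : f ∘ₗ structMap R M Y = 0 := BalTensor.linearMap_ext fun m y => hf m y
    exact LinearMap.congr_fun this t)

/-- The half of the adjunction between cokernel and stalk that is needed: a map to a module on which
M acts as zero kills the image of the structure map. -/
lemma stalkHom_surjective (g : Y →ₗ[TensorRing R M] Stalk R M W) :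
    ∃ f : Coker R M Y →ₗ[R] W, stalkHom f = g :=
  ⟨cokerDesc ((toStalk R M W).symm.toLinearMap ∘ₗ g.restrictScalars R) (fun m y => by
    simp [gen_smul_stalk]), LinearMap.ext fun _ => rfl⟩

end Pairs

/-! ### Induced modules and the sequence Ind(M ⊗ W) → Ind(W) → W -/

section Induced

variable {Y W : Type u} [AddCommGroup Y] [Module R Y] [Module (TensorRing R M) Y]
  [IsScalarTower R (TensorRing R M) Y] [AddCommGroup W] [Module R W]

variable (R M W) in
/-- The inclusion of `Mⁱ ⊗_R W` into `Ind(W)`. -/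
def indIncl (i : ℕ) : tpowTensor R M (ModuleCat.of R W) i →ₗ[R] Ind R M W := indOf R M W i

variable (R M W) in
/-- The inclusion of `W` into `Ind(W)`. -/
def indUnit : W →ₗ[R] Ind R M W :=
  indIncl R M W 0 ∘ₗ (tpowZero R M (ModuleCat.of R W)).toLinearMap

lemma gen_smul_indIncl (m : M) (i : ℕ) (y : tpowTensor R M (ModuleCat.of R W) i) :
    gen R m • indIncl R M W i y =
      indIncl R M W (i + 1) (tpowSucc R M (ModuleCat.of R W) i (BalTensor.tmul R m y)) :=
  (gen_smul_pair _ m _).trans (indMap_tmul_of R M W m i y)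

lemma ind_addHom_ext {P : Type*} [AddCommGroup P] {f g : Ind R M W →+ P}
    (h : ∀ i y, f (indIncl R M W i y) = g (indIncl R M W i y)) : f = g :=
  DirectSum.addHom_ext (β := fun i => tpowTensor R M (ModuleCat.of R W) i) (f := f) (g := g) h

/-- Ind(W) is generated over the tensor ring by its degree-zero part, since acting with elements of
M reaches generators of the next degree. -/
lemma ind_hom_ext {Y : Type*} [AddCommGroup Y] [Module (TensorRing R M) Y]
    {f g : Ind R M W →ₗ[TensorRing R M] Y}
    (h : ∀ w, f (indUnit R M W w) = g (indUnit R M W w)) : f = g := by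
  refine LinearMap.toAddMonoidHom_injective (ind_addHom_ext fun i => ?_)
  change ∀ y, f (indIncl R M W i y) = g (indIncl R M W i y)
  induction i with
  | zero => exact h
  | succ i ih =>
    intro y
    obtain ⟨z, rfl⟩ := (tpowSucc R M (ModuleCat.of R W) i).surjective y
    induction z using BalTensor.induction_on with
    | zero => simp
    | tmul m y => rw [← gen_smul_indIncl, map_smul, map_smul, ih]
    | add s t hs ht => rw [map_add, map_add, map_add, map_add, hs, ht]

/-- The map `Mⁱ ⊗_R W → Y` induced by `W → Y`. -/
def indLiftAux (g : W →ₗ[R] Y) : (i : ℕ) → tpowTensor R M (ModuleCat.of R W) i →ₗ[R] Y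
  | 0 => g ∘ₗ (tpowZero R M (ModuleCat.of R W)).symm.toLinearMap
  | i + 1 => structMap R M Y ∘ₗ BalTensor.lTensorLin M (indLiftAux g i) ∘ₗ
      (tpowSucc R M (ModuleCat.of R W) i).symm.toLinearMap

/-- The `R`-linear map underlying `indLift`. -/
def indLiftLin (g : W →ₗ[R] Y) : Ind R M W →ₗ[R] Y :=
  DirectSum.toModule R ℕ Y (indLiftAux g)

lemma indLiftLin_indIncl (g : W →ₗ[R] Y) (i : ℕ) (y : tpowTensor R M (ModuleCat.of R W) i) :
    indLiftLin g (indIncl R M W i y) = indLiftAux g i y :=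
  DirectSum.toModule_lof (M := fun i => tpowTensor R M (ModuleCat.of R W) i) R _ _

/-- The universal property of `Ind(W)`. -/
def indLift (g : W →ₗ[R] Y) : Ind R M W →ₗ[TensorRing R M] Y :=
  linearOfGen (indLiftLin g) fun m x =>
    DFunLike.congr_fun (ind_addHom_ext
      (f := (indLiftLin g).toAddMonoidHom.comp (DistribSMul.toAddMonoidHom _ (gen R m)))
      (g := (DistribSMul.toAddMonoidHom Y (gen R m)).comp (indLiftLin g).toAddMonoidHom)
      fun i y => by
        change indLiftLin g (gen R m • indIncl R M W i y) =
          gen R m • indLiftLin g (indIncl R M W i y)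
        rw [gen_smul_indIncl, indLiftLin_indIncl, indLiftLin_indIncl]
        rfl) x

@[simp]
lemma indLift_indUnit (g : W →ₗ[R] Y) (w : W) : indLift g (indUnit R M W w) = g w :=
  indLiftLin_indIncl g 0 _

variable (R M W) in
/-- The projection of `Ind(W)` onto `W`. -/
def indToStalk : Ind R M W →ₗ[TensorRing R M] Stalk R M W :=
  indLift (toStalk R M W).toLinearMap

variable (R M W) in
/-- The homomorphism `Ind(M ⊗_R W) → Ind(W)` onto the part of positive degree. -/
def indShiftIncl : Ind R M (BalTensor R M W) →ₗ[TensorRing R M] Ind R M W :=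
  indLift (indIncl R M W 1 ∘ₗ (tpowSucc R M (ModuleCat.of R W) 0).toLinearMap)

lemma indToStalk_indUnit (w : W) : indToStalk R M W (indUnit R M W w) = toStalk R M W w :=
  indLift_indUnit _ w

lemma indToStalk_surjective : Function.Surjective (indToStalk R M W) := fun w =>
  ⟨indUnit R M W ((toStalk R M W).symm w), by rw [indToStalk_indUnit]; rfl⟩

lemma indToStalk_indIncl_succ (i : ℕ) (y : tpowTensor R M (ModuleCat.of R W) (i + 1)) :
    indToStalk R M W (indIncl R M W (i + 1) y) = 0 := by
  obtain ⟨z, rfl⟩ := (tpowSucc R M (ModuleCat.of R W) i).surjective y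
  induction z using BalTensor.induction_on with
  | zero => simp
  | tmul m y => rw [← gen_smul_indIncl, map_smul, gen_smul_stalk]
  | add s t hs ht => rw [map_add, map_add, map_add, hs, ht, add_zero]

lemma indShiftIncl_indIncl (i : ℕ)
    (y : tpowTensor R M (ModuleCat.of R (BalTensor R M W)) i) :
    indShiftIncl R M W (indIncl R M _ i y) =
      indIncl R M W (i + 1) (tpowTensorShift R M W i y) := by
  induction i with
  | zero => exact indLift_indUnit _ _
  | succ i ih =>
    obtain ⟨z, rfl⟩ := (tpowSucc R M _ i).surjective y
    induction z using BalTensor.induction_on with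
    | zero => simp
    | tmul m y =>
      rw [← gen_smul_indIncl, map_smul, ih, tpowTensorShift_succ_tmul, gen_smul_indIncl]
    | add s t hs ht => simp only [map_add, hs, ht]

variable (R M W) in
/-- The additive retraction of `indShiftIncl` which kills the part of degree zero. -/
def indShiftRetract : Ind R M W →+ Ind R M (BalTensor R M W) :=
  DirectSum.toAddMonoid fun i => match i with
    | 0 => 0
    | i + 1 => (indIncl R M (BalTensor R M W) i).toAddMonoidHom.comp
        (tpowTensorShift R M W i).symm.toLinearMap.toAddMonoidHom

lemma indShiftRetract_indIncl_zero (y : tpowTensor R M (ModuleCat.of R W) 0) :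
    indShiftRetract R M W (indIncl R M W 0 y) = 0 :=
  DirectSum.toAddMonoid_of _ _ _

lemma indShiftRetract_indIncl_succ (i : ℕ) (y : tpowTensor R M (ModuleCat.of R W) (i + 1)) :
    indShiftRetract R M W (indIncl R M W (i + 1) y) =
      indIncl R M (BalTensor R M W) i ((tpowTensorShift R M W i).symm y) :=
  DirectSum.toAddMonoid_of _ _ _

lemma indShiftIncl_injective : Function.Injective (indShiftIncl R M W) := by
  refine Function.LeftInverse.injective (g := indShiftRetract R M W) (DFunLike.congr_fun
    (f := (indShiftRetract R M W).comp (indShiftIncl R M W).toAddMonoidHom)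
    (g := AddMonoidHom.id _) (ind_addHom_ext fun i y => ?_))
  change indShiftRetract R M W (indShiftIncl R M W (indIncl R M _ i y)) = _
  rw [indShiftIncl_indIncl, indShiftRetract_indIncl_succ, LinearEquiv.symm_apply_apply]
  rfl

lemma indShiftIncl_exact_indToStalk :
    Function.Exact (indShiftIncl R M W) (indToStalk R M W) := by
  -- Each element is the sum of its positive-degree part and its degree-zero part, and the second is
  -- determined by the projection to W.
  have hdec : ∀ x, indShiftIncl R M W (indShiftRetract R M W x) +
      indUnit R M W ((toStalk R M W).symm (indToStalk R M W x)) = x := by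
    refine DFunLike.congr_fun (f := (indShiftIncl R M W).toAddMonoidHom.comp
      (indShiftRetract R M W) + (indUnit R M W ∘ₗ (toStalk R M W).symm.toLinearMap).toAddMonoidHom.comp
      (indToStalk R M W).toAddMonoidHom) (g := AddMonoidHom.id _) (ind_addHom_ext fun i y => ?_)
    change indShiftIncl R M W (indShiftRetract R M W (indIncl R M W i y)) +
      indUnit R M W ((toStalk R M W).symm (indToStalk R M W (indIncl R M W i y))) =
        indIncl R M W i y
    cases i with
    | zero =>
      rw [indShiftRetract_indIncl_zero, map_zero, zero_add]
      exact congrArg (indUnit R M W) (indToStalk_indUnit _)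
    | succ i =>
      rw [indShiftRetract_indIncl_succ, indShiftIncl_indIncl, LinearEquiv.apply_symm_apply,
        indToStalk_indIncl_succ, map_zero, map_zero, add_zero]
  intro x
  constructor
  · intro hx
    refine ⟨indShiftRetract R M W x, ?_⟩
    conv_rhs => rw [← hdec x]
    rw [hx, map_zero, map_zero, add_zero]
  · rintro ⟨y, rfl⟩
    have : indToStalk R M W ∘ₗ indShiftIncl R M W = 0 := ind_hom_ext fun w => by
      rw [LinearMap.comp_apply, indShiftIncl, indLift_indUnit]
      exact indToStalk_indIncl_succ 0 _
    exact LinearMap.congr_fun this y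

lemma subsingleton_ind_of_subsingleton [Subsingleton W] : Subsingleton (Ind R M W) := by
  refine subsingleton_of_forall_eq 0 fun x => ?_
  have : (LinearMap.id : Ind R M W →ₗ[TensorRing R M] Ind R M W) = 0 := ind_hom_ext fun w => by
    rw [Subsingleton.elim w 0, map_zero, map_zero, map_zero]
  exact LinearMap.congr_fun this x

end Induced

end TensorRing

namespace TensorRing

variable {R : Type u} [Ring R] {M : Type u} [AddCommGroup M] [Module R M] [Module Rᵐᵒᵖ M]
  [SMulCommClass R Rᵐᵒᵖ M]

/-! ### Restriction of scalars to `R` -/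

section Restrict

variable (R M)

/-- The `R`-module structure on a `T_R(M)`-module. -/
abbrev restrictModule (Y : Type u) [AddCommGroup Y] [Module (TensorRing R M) Y] : Module R Y :=
  Module.compHom Y (incl R M)

lemma isScalarTower_restrictModule (Y : Type u) [AddCommGroup Y] [Module (TensorRing R M) Y] :
    letI := restrictModule R M Y
    IsScalarTower R (TensorRing R M) Y :=
  letI := restrictModule R M Y
  ⟨fun r t y => by
    rw [← scalar_mul, mul_smul]
    rfl⟩

/-- The right `R`-module structure on a right `T_R(M)`-module. -/
abbrev restrictRightModule (A : Type u) [AddCommGroup A] [Module (TensorRing R M)ᵐᵒᵖ A] :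
    Module Rᵐᵒᵖ A :=
  Module.compHom A (incl R M).op

lemma isScalarTower_leftDual (A : Type u) [AddCommGroup A] [Module (TensorRing R M)ᵐᵒᵖ A] :
    letI := restrictRightModule R M A
    IsScalarTower R (TensorRing R M) (LeftDual A) :=
  letI := restrictRightModule R M A
  ⟨fun r t φ => LeftDual.ext fun a => by
    rw [← scalar_mul, LeftDual.smul_apply, MulOpposite.op_mul, mul_smul]
    rfl⟩

end Restrict

/-! ### The augmentation -/

section Augmentation

/-- Positive degrees act as zero on a stalk module, so t acts through its degree-zero component.
Reading that component off as t • 1 in the stalk of R is what makes the augmentation multiplicative.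
-/
lemma smul_stalk_eq {W : Type u} [AddCommGroup W] [Module R W] (t : TensorRing R M)
    (w : Stalk R M W) :
    t • w = (toStalk R M R).symm (t • toStalk R M R (1 : R)) • w := by
  induction t using TensorRing.induction_on with
  | zero => simp
  | scalar r => rw [scalar_smul, scalar_smul, map_smul, LinearEquiv.symm_apply_apply, smul_eq_mul,
      mul_one]
  | tmul m i y => rw [shift_tmul, mul_smul, mul_smul, gen_smul_stalk, gen_smul_stalk, map_zero,
      zero_smul]
  | add s t hs ht => rw [add_smul, add_smul, map_add, add_smul, hs, ht]

variable (R M) in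
/-- The projection of `T_R(M)` onto the summand of degree zero. -/
def augmentation : TensorRing R M →+* R where
  toFun t := (toStalk R M R).symm (t • toStalk R M R (1 : R))
  map_one' := by rw [one_smul, LinearEquiv.symm_apply_apply]
  map_zero' := by rw [zero_smul, map_zero]
  map_add' s t := by rw [add_smul, map_add]
  map_mul' s t := by rw [mul_smul, smul_stalk_eq s, map_smul, smul_eq_mul]

lemma augmentation_scalar (r : R) : augmentation R M (scalar R M r) = r := by
  change (toStalk R M R).symm (scalar R M r • toStalk R M R (1 : R)) = r
  rw [scalar_smul, map_smul, LinearEquiv.symm_apply_apply, smul_eq_mul, mul_one]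

lemma augmentation_gen (m : M) : augmentation R M (gen R m) = 0 := by
  change (toStalk R M R).symm (gen R m • toStalk R M R (1 : R)) = 0
  rw [gen_smul_stalk, map_zero]

lemma augmentation_shift (m : M) (t : TensorRing R M) :
    augmentation R M (shift R M (BalTensor.tmul R m t)) = 0 := by
  rw [shift_tmul, map_mul, augmentation_gen, zero_mul]

/-- Positive degrees map Y into the image of the structure map, so the tensor ring acts on the
cokernel through the augmentation. -/
lemma mk_smul {Y : Type u} [AddCommGroup Y] [Module R Y] [Module (TensorRing R M) Y]
    [IsScalarTower R (TensorRing R M) Y] (t : TensorRing R M) (y : Y) :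
    (LinearMap.range (structMap R M Y)).mkQ (t • y) =
      augmentation R M t • (LinearMap.range (structMap R M Y)).mkQ y := by
  induction t using TensorRing.induction_on with
  | zero => rw [zero_smul, map_zero, map_zero, zero_smul]
  | scalar r => rw [scalar_smul, augmentation_scalar, map_smul]
  | tmul m i z => rw [augmentation_shift, shift_tmul, mul_smul, mk_gen_smul, zero_smul]
  | add s t hs ht => rw [add_smul, map_add, hs, ht, map_add, add_smul]

end Augmentation

/-! ### Flat modules over the tensor ring -/

section Flat

variable {Y W : Type u} [AddCommGroup Y] [Module R Y] [Module (TensorRing R M) Y]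
  [IsScalarTower R (TensorRing R M) Y] [AddCommGroup W] [Module R W]

variable (R M) in
/-- The right ideal of `T_R(M)` of elements of positive degree. -/
def positivePart : Submodule (TensorRing R M)ᵐᵒᵖ (TensorRing R M) where
  carrier := Set.range (shift R M)
  zero_mem' := ⟨0, map_zero _⟩
  add_mem' := by
    rintro _ _ ⟨s, rfl⟩ ⟨t, rfl⟩
    exact ⟨s + t, map_add _ _ _⟩
  smul_mem' := by
    rintro s _ ⟨t, rfl⟩
    induction t using BalTensor.induction_on with
    | zero => exact ⟨0, by simp⟩
    | tmul m t => exact ⟨BalTensor.tmul R m (t * s.unop), (shift_mul m t s.unop).symm⟩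
    | add t t' h h' =>
      obtain ⟨z, hz⟩ := h
      obtain ⟨z', hz'⟩ := h'
      exact ⟨z + z', by rw [map_add, map_add, smul_add, hz, hz']⟩

variable (R M) in
/-- The positive part of `T_R(M)` is `M ⊗_R T_R(M)`. -/
def shiftEquiv : BalTensor R M (TensorRing R M) ≃+ positivePart R M :=
  AddEquiv.ofBijective
    (AddMonoidHom.mk' (fun t => (⟨shift R M t, t, rfl⟩ : positivePart R M))
      fun s t => Subtype.ext (map_add _ s t))
    ⟨fun _ _ h => shift_injective (congrArg Subtype.val h),
      fun ⟨_, t, h⟩ => ⟨t, Subtype.ext h⟩⟩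

lemma op_smul_shiftEquiv_tmul (m : M) (s t : TensorRing R M) :
    MulOpposite.op s • shiftEquiv R M (BalTensor.tmul R m t) =
      shiftEquiv R M (BalTensor.tmul R m (t * s)) :=
  Subtype.ext (shift_mul m t s)

/-- The map `(m ⊗ t, y) ↦ m ⊗ t y`. -/
def tensorOrbit (y : Y) : BalTensor R M (TensorRing R M) →+ BalTensor R M Y :=
  BalTensor.lTensor M ((LinearMap.toSpanSingleton (TensorRing R M) Y y).restrictScalars R)

lemma tensorOrbit_tmul (y : Y) (m : M) (t : TensorRing R M) :
    tensorOrbit y (BalTensor.tmul R m t) = BalTensor.tmul R m (t • y) := rfl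

/-- The homomorphism `y ↦ (m ⊗ t ↦ χ (m ⊗ t y))`. -/
def characterOrbit (χ : BalTensor R M Y →+ AddCircle (1 : ℚ)) :
    Y →ₗ[TensorRing R M] LeftDual (positivePart R M) where
  toFun y := (χ.comp (tensorOrbit y)).comp (shiftEquiv R M).symm.toAddMonoidHom
  map_add' y y' := LeftDual.ext fun a => by
    obtain ⟨t, rfl⟩ := (shiftEquiv R M).surjective a
    change χ (tensorOrbit (y + y') ((shiftEquiv R M).symm (shiftEquiv R M t))) =
      χ (tensorOrbit y ((shiftEquiv R M).symm (shiftEquiv R M t))) +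
        χ (tensorOrbit y' ((shiftEquiv R M).symm (shiftEquiv R M t)))
    rw [AddEquiv.symm_apply_apply, ← map_add]
    refine congrArg χ (DFunLike.congr_fun (BalTensor.addHom_ext (f := tensorOrbit (y + y'))
      (g := tensorOrbit y + tensorOrbit y') fun m t => ?_) t)
    rw [AddMonoidHom.add_apply, tensorOrbit_tmul, tensorOrbit_tmul, tensorOrbit_tmul, smul_add,
      BalTensor.tmul_add]
  map_smul' s y := LeftDual.ext fun a => by
    obtain ⟨t, rfl⟩ := (shiftEquiv R M).surjective a
    change χ (tensorOrbit (s • y) ((shiftEquiv R M).symm (shiftEquiv R M t))) =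
      χ (tensorOrbit y ((shiftEquiv R M).symm (MulOpposite.op s • shiftEquiv R M t)))
    rw [AddEquiv.symm_apply_apply]
    refine DFunLike.congr_fun (BalTensor.addHom_ext (f := χ.comp (tensorOrbit (s • y)))
      (g := ((χ.comp (tensorOrbit y)).comp (shiftEquiv R M).symm.toAddMonoidHom).comp
        ((DistribSMul.toAddMonoidHom _ (MulOpposite.op s)).comp (shiftEquiv R M).toAddMonoidHom))
      fun m t => ?_) t
    change χ (tensorOrbit (s • y) (BalTensor.tmul R m t)) = χ (tensorOrbit y
      ((shiftEquiv R M).symm (MulOpposite.op s • shiftEquiv R M (BalTensor.tmul R m t))))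
    rw [op_smul_shiftEquiv_tmul, AddEquiv.symm_apply_apply, tensorOrbit_tmul, tensorOrbit_tmul,
      mul_smul]

lemma characterOrbit_shiftEquiv (χ : BalTensor R M Y →+ AddCircle (1 : ℚ)) (y : Y) (m : M)
    (t : TensorRing R M) :
    characterOrbit χ y (shiftEquiv R M (BalTensor.tmul R m t)) =
      χ (BalTensor.tmul R m (t • y)) := by
  change χ (tensorOrbit y ((shiftEquiv R M).symm (shiftEquiv R M (BalTensor.tmul R m t)))) = _
  rw [AddEquiv.symm_apply_apply, tensorOrbit_tmul]

/-- The structure map of a flat `T_R(M)`-module is injective. -/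
lemma structMap_injective_of_flat (hY : IsFlatModule (TensorRing R M) Y) :
    Function.Injective (structMap R M Y) := by
  refine (injective_iff_forall_character (structMap R M Y).toAddMonoidHom).2 fun χ => ?_
  -- A character of M ⊗ Y becomes a homomorphism from Y to the character module of the positive
  -- part. Flatness lifts it to the character module of the whole tensor ring, and evaluating the
  -- lift at 1 gives a character of Y that extends χ.
  obtain ⟨h, hh⟩ := (isFlatModule_iff Y).1 hY _ _ (positivePart R M).subtype
    Subtype.val_injective (characterOrbit χ)
  refine ⟨AddMonoidHom.mk' (fun y => h y 1) fun y y' => by rw [map_add, LeftDual.add_apply],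
    DFunLike.congr_fun (BalTensor.addHom_ext (f := (AddMonoidHom.mk' (fun y => h y 1) fun y y' =>
      by rw [map_add, LeftDual.add_apply]).comp (structMap R M Y).toAddMonoidHom) (g := χ)
      fun m y => ?_)⟩
  change h (gen R m • y) 1 = χ (BalTensor.tmul R m y)
  rw [map_smul, LeftDual.smul_apply, op_smul_eq_mul, one_mul]
  have := DFunLike.congr_fun (LinearMap.congr_fun hh y) (shiftEquiv R M (BalTensor.tmul R m 1))
  rw [characterOrbit_shiftEquiv, one_smul] at this
  exact this

/-- The cokernel of the structure map of a flat `T_R(M)`-module is flat. -/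
lemma isFlatModule_coker (hY : IsFlatModule (TensorRing R M) Y) :
    IsFlatModule R (Coker R M Y) := by
  refine (isFlatModule_iff _).2 fun A B _ _ _ _ f hf h => ?_
  -- With A and B regarded as right modules over the tensor ring through the augmentation, maps from
  -- Y to A⁺ are maps from the cokernel to A⁺, so the lifting property of Y descends.
  let : Module (TensorRing R M)ᵐᵒᵖ A := Module.compHom A (augmentation R M).op
  let : Module (TensorRing R M)ᵐᵒᵖ B := Module.compHom B (augmentation R M).op
  let f' : A →ₗ[(TensorRing R M)ᵐᵒᵖ] B :=
    { f with map_smul' := fun t a => f.map_smul ((augmentation R M).op t) a }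
  have hsmulA : ∀ (t : TensorRing R M) (φ : LeftDual A), t • φ = augmentation R M t • φ :=
    fun _ _ => rfl
  have hsmulB : ∀ (t : TensorRing R M) (φ : LeftDual B), t • φ = augmentation R M t • φ :=
    fun _ _ => rfl
  let h₁ : Y →ₗ[TensorRing R M] LeftDual A :=
    { toFun := fun y => h ((LinearMap.range (structMap R M Y)).mkQ y)
      map_add' := fun y y' => by rw [map_add, map_add]
      map_smul' := fun t y => by rw [mk_smul, map_smul, RingHom.id_apply, hsmulA] }
  obtain ⟨h₂, hh₂⟩ := (isFlatModule_iff Y).1 hY A B f' hf h₁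
  let h₃ : Y →ₗ[R] LeftDual B :=
    { toFun := h₂
      map_add' := map_add h₂
      map_smul' := fun r y => by
        rw [← scalar_smul (M := M), map_smul, hsmulB, augmentation_scalar, RingHom.id_apply] }
  refine ⟨cokerDesc (M := M) h₃ fun m y => ?_, ?_⟩
  · change h₂ (gen R m • y) = 0
    rw [map_smul, hsmulB, augmentation_gen, zero_smul]
  · refine LinearMap.ext fun z => ?_
    obtain ⟨y, rfl⟩ := Submodule.mkQ_surjective _ z
    exact LinearMap.congr_fun hh₂ y

/-- Homomorphisms of induced modules. -/
def indFunctorMap {V : Type u} [AddCommGroup V] [Module R V] (f : V →ₗ[R] W) :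
    Ind R M V →ₗ[TensorRing R M] Ind R M W := indLift (indUnit R M W ∘ₗ f)

lemma indFunctorMap_indUnit {V : Type u} [AddCommGroup V] [Module R V] (f : V →ₗ[R] W) (v : V) :
    indFunctorMap (M := M) f (indUnit R M V v) = indUnit R M W (f v) := indLift_indUnit _ v

variable {K P G : Type u} [AddCommGroup K] [AddCommGroup P] [AddCommGroup G] [Module R K]
  [Module R P] [Module R G] {i : K →ₗ[R] P} {p : P →ₗ[R] G}

/-- The cokernel of `Ind(K) → Ind(P)` is flat if the cokernel of `K → P` is. -/
lemma isFlatModule_ind_quotient (hG : IsFlatModule R G) (hp : Function.Surjective p)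
    (hip : Function.Exact i p) :
    IsFlatModule (TensorRing R M) (Ind R M P ⧸ LinearMap.range (indFunctorMap (M := M) i)) := by
  refine (isFlatModule_iff _).2 fun A B _ _ _ _ f hf h => ?_
  let := restrictRightModule R M A
  let := restrictRightModule R M B
  have := isScalarTower_leftDual R M A
  have := isScalarTower_leftDual R M B
  let f' : A →ₗ[Rᵐᵒᵖ] B := { f with map_smul' := fun r a => f.map_smul ((incl R M).op r) a }
  let h₁ := h ∘ₗ (LinearMap.range (indFunctorMap (M := M) i)).mkQ
  -- A map from the quotient to A⁺ restricts to an R-map on P that vanishes on K, hence comes from a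
  -- map on G. The quotient thus behaves like Ind(G), and the lifting is done over R.
  obtain ⟨h₂, hh₂⟩ := exists_factor_of_exact hp hip (h₁.restrictScalars R ∘ₗ indUnit R M P) (by
    ext k : 1
    change h ((LinearMap.range (indFunctorMap (M := M) i)).mkQ (indUnit R M P (i k))) = 0
    rw [← indFunctorMap_indUnit, Submodule.mkQ_apply,
      (Submodule.Quotient.mk_eq_zero _).2 (LinearMap.mem_range_self _ _), map_zero])
  obtain ⟨h₃, hh₃⟩ := (isFlatModule_iff G).1 hG A B f' hf h₂
  refine ⟨(LinearMap.range (indFunctorMap (M := M) i)).liftQ (indLift (h₃ ∘ₗ p)) ?_, ?_⟩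
  · have : indLift (h₃ ∘ₗ p) ∘ₗ indFunctorMap (M := M) i = 0 := ind_hom_ext fun k => by
      rw [LinearMap.comp_apply, indFunctorMap_indUnit, indLift_indUnit, LinearMap.comp_apply,
        hip.apply_apply_eq_zero, map_zero]
      rfl
    rintro _ ⟨x, rfl⟩
    exact LinearMap.congr_fun this x
  · have : LeftDual.map f ∘ₗ indLift (h₃ ∘ₗ p) = h₁ := ind_hom_ext fun x => by
      rw [LinearMap.comp_apply, indLift_indUnit]
      exact (LinearMap.congr_fun hh₃ (p x)).trans (LinearMap.congr_fun hh₂ x)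
    refine LinearMap.ext fun z => ?_
    obtain ⟨x, rfl⟩ := Submodule.mkQ_surjective _ z
    exact LinearMap.congr_fun this x

/-- The induced module of a flat module is flat. -/
lemma isFlatModule_ind (hW : IsFlatModule R W) : IsFlatModule (TensorRing R M) (Ind R M W) := by
  refine (isFlatModule_iff _).2 fun A B _ _ _ _ f hf h => ?_
  let := restrictRightModule R M A
  let := restrictRightModule R M B
  have := isScalarTower_leftDual R M A
  have := isScalarTower_leftDual R M B
  let f' : A →ₗ[Rᵐᵒᵖ] B := { f with map_smul' := fun r a => f.map_smul ((incl R M).op r) a }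
  obtain ⟨h', hh'⟩ := (isFlatModule_iff W).1 hW A B f' hf (h.restrictScalars R ∘ₗ indUnit R M W)
  refine ⟨indLift h', ind_hom_ext fun w => ?_⟩
  rw [LinearMap.comp_apply, indLift_indUnit]
  exact LinearMap.congr_fun hh' w

/-- `Ind` preserves monomorphisms with flat cokernel. -/
lemma indFunctorMap_injective (hG : IsFlatModule R G) (hi : Function.Injective i)
    (hp : Function.Surjective p) (hip : Function.Exact i p) :
    Function.Injective (indFunctorMap (M := M) i) := by
  refine (injective_iff_forall_character (indFunctorMap (M := M) i).toAddMonoidHom).2 fun χ => ?_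
  let := restrictRightModule R M (TensorRing R M)
  have := isScalarTower_leftDual R M (TensorRing R M)
  -- A character is recovered by evaluation at 1 from the linear map x ↦ (t ↦ χ (t • x)). Restricted
  -- to K, this map extends to P by purity, and then to Ind(P) by the universal property.
  let χ' : Ind R M K →ₗ[TensorRing R M] LeftDual (TensorRing R M) :=
    { toFun := fun x => AddMonoidHom.mk' (fun t => χ (t • x)) fun s t => by
        rw [add_smul, map_add]
      map_add' := fun x y => LeftDual.ext fun t =>
        (congrArg χ (smul_add t x y)).trans (map_add χ _ _)
      map_smul' := fun s x => LeftDual.ext fun t => congrArg χ (mul_smul t s x).symm }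
  obtain ⟨g, hg⟩ := hG.exists_extension_leftDual hi hp hip
    (χ'.restrictScalars R ∘ₗ indUnit R M K)
  have hψ : indLift g ∘ₗ indFunctorMap (M := M) i = χ' := ind_hom_ext fun k => by
    rw [LinearMap.comp_apply, indFunctorMap_indUnit, indLift_indUnit]
    exact LinearMap.congr_fun hg k
  refine ⟨AddMonoidHom.mk' (fun x => indLift g x 1) fun x y => by
    rw [map_add, LeftDual.add_apply], fun x => ?_⟩
  refine (DFunLike.congr_fun (LinearMap.congr_fun hψ x) 1).trans ?_
  exact congrArg χ (one_smul _ x)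

end Flat

/-! ### Cotorsion modules over the tensor ring -/

section Cotorsion

section CokerExact

variable {K P G : Type u} [AddCommGroup K] [AddCommGroup P] [AddCommGroup G] [Module R K]
  [Module R P] [Module R G] [Module (TensorRing R M) K] [Module (TensorRing R M) P]
  [Module (TensorRing R M) G] [IsScalarTower R (TensorRing R M) K]
  [IsScalarTower R (TensorRing R M) P] [IsScalarTower R (TensorRing R M) G]
  {i : K →ₗ[TensorRing R M] P} {p : P →ₗ[TensorRing R M] G}

lemma cokerMap_surjective (hp : Function.Surjective p) : Function.Surjective (cokerMap p) := by
  intro z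
  obtain ⟨y, rfl⟩ := Submodule.mkQ_surjective _ z
  obtain ⟨x, rfl⟩ := hp y
  exact ⟨(LinearMap.range (structMap R M P)).mkQ x, rfl⟩

lemma cokerMap_exact (hp : Function.Surjective p) (hip : Function.Exact i p) :
    Function.Exact (cokerMap i) (cokerMap p) := by
  intro z
  obtain ⟨x, rfl⟩ := Submodule.mkQ_surjective _ z
  constructor
  · intro hz
    obtain ⟨t, ht⟩ := (Submodule.Quotient.mk_eq_zero _).1 hz
    obtain ⟨s, rfl⟩ := BalTensor.lTensor_surjective (f := p.restrictScalars R) hp t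
    rw [structMap_lTensor] at ht
    obtain ⟨k, hk⟩ := (hip (x - structMap R M P s)).1 (by
      rw [map_sub, ht, sub_eq_zero]
      rfl)
    refine ⟨(LinearMap.range (structMap R M K)).mkQ k, ?_⟩
    rw [cokerMap_mk, hk, map_sub, sub_eq_self]
    exact (Submodule.Quotient.mk_eq_zero _).2 ⟨s, rfl⟩
  · rintro ⟨w, hw⟩
    obtain ⟨k, rfl⟩ := Submodule.mkQ_surjective _ w
    rw [← hw, cokerMap_mk, cokerMap_mk, hip.apply_apply_eq_zero, map_zero]

/-- If the structure map of P sends t ∈ M ⊗ P into K, then t dies in M ⊗ G because the structure map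
of G is injective. By right exactness t comes from M ⊗ K. -/
lemma cokerMap_injective (hG : Function.Injective (structMap R M G)) (hi : Function.Injective i)
    (hp : Function.Surjective p) (hip : Function.Exact i p) :
    Function.Injective (cokerMap i) := by
  rw [injective_iff_map_eq_zero]
  intro z hz
  obtain ⟨k, rfl⟩ := Submodule.mkQ_surjective _ z
  obtain ⟨t, ht⟩ := (Submodule.Quotient.mk_eq_zero _).1 hz
  have ht' : structMap R M P t = i k := ht
  have h0 : BalTensor.lTensor M (p.restrictScalars R) t = 0 := hG (by
    rw [structMap_lTensor, ht', hip.apply_apply_eq_zero, map_zero])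
  obtain ⟨s, rfl⟩ := (BalTensor.lTensor_exact (f := i.restrictScalars R)
    (g := p.restrictScalars R) hp hip t).1 h0
  rw [structMap_lTensor] at ht'
  exact (Submodule.Quotient.mk_eq_zero _).2 ⟨s, hi ht'⟩

end CokerExact

/-- The stalk module of a cotorsion module is cotorsion. -/
lemma isCotorsionModule_stalk {V : Type u} [AddCommGroup V] [Module R V]
    (hV : IsCotorsionModule R V) : IsCotorsionModule (TensorRing R M) (Stalk R M V) := by
  refine isCotorsionModule_of_forall_extension fun K P G _ _ _ _ _ _ _ i p hG hi hp hip f => ?_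
  let := restrictModule R M K
  let := restrictModule R M P
  let := restrictModule R M G
  have := isScalarTower_restrictModule R M K
  have := isScalarTower_restrictModule R M P
  have := isScalarTower_restrictModule R M G
  -- By adjunction the extension problem becomes one over R for the sequence of cokernels, which is
  -- short exact with flat last term because G is flat.
  obtain ⟨f, rfl⟩ := stalkHom_surjective f
  obtain ⟨g, rfl⟩ := hV.exists_extension (isFlatModule_coker hG)
    (cokerMap_injective (structMap_injective_of_flat hG) hi hp hip) (cokerMap_surjective hp)
    (cokerMap_exact hp hip) f
  exact ⟨stalkHom g, rfl⟩

/-- Ind(V) is an extension of the stalk of V by Ind(M ⊗ V). Passing from V to M ⊗ V lowers by one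
the tensor power that is known to vanish, so the induction must hold for all V at once. -/
lemma isCotorsionModule_ind_of_subsingleton_tpowTensor (hcot : PreservesCotorsion R M) (k : ℕ) :
    ∀ (V : Type u) [AddCommGroup V] [Module R V], IsCotorsionModule R V →
      Subsingleton (tpowTensor R M (ModuleCat.of R V) k) →
      IsCotorsionModule (TensorRing R M) (Ind R M V) := by
  induction k with
  | zero =>
    intro V _ _ _ h
    have : Subsingleton V := h
    have := subsingleton_ind_of_subsingleton (R := R) (M := M) (W := V)
    exact isCotorsionModule_of_subsingleton
  | succ k ih =>
    intro V _ _ hV h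
    refine (ih _ (hcot V hV) (tpowTensorShift R M V k).toEquiv.subsingleton).of_extension
      (isCotorsionModule_stalk hV) indShiftIncl_injective indToStalk_surjective
      indShiftIncl_exact_indToStalk

/-- The induced module of a cotorsion module is cotorsion if `M` is nilpotent. -/
lemma isCotorsionModule_ind {N : ℕ} (hN : IsNilpotentBimodule R M N)
    (hcot : PreservesCotorsion R M) {V : Type u} [AddCommGroup V] [Module R V]
    (hV : IsCotorsionModule R V) : IsCotorsionModule (TensorRing R M) (Ind R M V) :=
  isCotorsionModule_ind_of_subsingleton_tpowTensor hcot (N + 1) V hV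
    (hN.subsingleton_tpowTensor _)

variable {Y : Type u} [AddCommGroup Y] [Module R Y] [Module (TensorRing R M) Y]
  [IsScalarTower R (TensorRing R M) Y]

/-- Restriction of scalars to `R` preserves cotorsion modules. -/
lemma isCotorsionModule_restrict (hY : IsCotorsionModule (TensorRing R M) Y) :
    IsCotorsionModule R Y :=
  isCotorsionModule_of_forall_extension fun K P G _ _ _ _ _ _ _ i p hG hi hp hip f => by
    -- Induction is left adjoint to restriction, and it carries K → P to a monomorphism with flat
    -- cokernel. So f can be extended over the tensor ring and restricted to degree zero.
    obtain ⟨g, hg⟩ := hY.exists_extension (isFlatModule_ind_quotient (M := M) hG hp hip)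
      (indFunctorMap_injective hG hi hp hip) (Submodule.mkQ_surjective _)
      (LinearMap.exact_map_mkQ_range _) (indLift f)
    refine ⟨g.restrictScalars R ∘ₗ indUnit R M P, LinearMap.ext fun k => ?_⟩
    have := LinearMap.congr_fun hg (indUnit R M K k)
    rw [indLift_indUnit, LinearMap.comp_apply, indFunctorMap_indUnit] at this
    exact this

/-- The cokernel of the structure map of a flat-cotorsion `T_R(M)`-module is flat-cotorsion. -/
lemma isFlatCotorsion_coker (hcot : PreservesCotorsion R M)
    (hY : IsFlatCotorsion (TensorRing R M) Y) : IsFlatCotorsion R (Coker R M Y) :=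
  -- The cokernel is the quotient of Y by M ⊗ Y, which is cotorsion by the assumption on M and
  -- embeds in Y by flatness.
  ⟨isFlatModule_coker hY.1, (hcot Y (isCotorsionModule_restrict hY.2)).of_exact
    (isCotorsionModule_restrict hY.2) (structMap_injective_of_flat hY.1)
    (Submodule.mkQ_surjective _) (LinearMap.exact_map_mkQ_range _)⟩

lemma isFlatCotorsion_ind {N : ℕ} (hN : IsNilpotentBimodule R M N)
    (hcot : PreservesCotorsion R M) {V : Type u} [AddCommGroup V] [Module R V]
    (hV : IsFlatCotorsion R V) : IsFlatCotorsion (TensorRing R M) (Ind R M V) :=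
  ⟨isFlatModule_ind hV.1, isCotorsionModule_ind hN hcot hV.2⟩

end Cotorsion

end TensorRing

namespace TensorRing

variable {R : Type u} [Ring R] {M : Type u} [AddCommGroup M] [Module R M] [Module Rᵐᵒᵖ M]
  [SMulCommClass R Rᵐᵒᵖ M]

/-! ### Cokernels of the structure maps along exact sequences -/

section ExactSequences

variable {A B C D : Type u} [AddCommGroup A] [AddCommGroup B] [AddCommGroup C] [AddCommGroup D]
  [Module R A] [Module R B] [Module R C] [Module R D] [Module (TensorRing R M) A]
  [Module (TensorRing R M) B] [Module (TensorRing R M) C] [Module (TensorRing R M) D]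
  [IsScalarTower R (TensorRing R M) A] [IsScalarTower R (TensorRing R M) B]
  [IsScalarTower R (TensorRing R M) C] [IsScalarTower R (TensorRing R M) D]
  {f : A →ₗ[TensorRing R M] B} {g : B →ₗ[TensorRing R M] C} {h : C →ₗ[TensorRing R M] D}

/-- If g b comes from t ∈ M ⊗ C, then t dies in M ⊗ D by injectivity for D, so t comes from some s
in M ⊗ B. Subtracting the image of s from b leaves its class unchanged and moves it into Ker g = Im
f. -/
lemma cokerMap_exact_of_exact (hD : Function.Injective (structMap R M D))
    (hfg : Function.Exact f g) (hgh : h ∘ₗ g = 0)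
    (ht : Function.Exact (BalTensor.lTensor M (g.restrictScalars R))
      (BalTensor.lTensor M (h.restrictScalars R))) :
    Function.Exact (cokerMap f) (cokerMap g) := by
  intro z
  obtain ⟨b, rfl⟩ := Submodule.mkQ_surjective _ z
  constructor
  · intro hz
    obtain ⟨t, hb⟩ := (Submodule.Quotient.mk_eq_zero _).1 hz
    have hb' : structMap R M C t = g b := hb
    obtain ⟨s, rfl⟩ := (ht t).1 (hD (by
      rw [structMap_lTensor, hb', map_zero]
      exact LinearMap.congr_fun hgh b))
    rw [structMap_lTensor] at hb'
    obtain ⟨a, ha⟩ := (hfg (b - structMap R M B s)).1 (by rw [map_sub, hb', sub_self])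
    refine ⟨(LinearMap.range (structMap R M A)).mkQ a, ?_⟩
    rw [cokerMap_mk, ha, map_sub, sub_eq_self]
    exact (Submodule.Quotient.mk_eq_zero _).2 ⟨s, rfl⟩
  · rintro ⟨w, hw⟩
    obtain ⟨a, rfl⟩ := Submodule.mkQ_surjective _ w
    rw [← hw, cokerMap_mk, cokerMap_mk, hfg.apply_apply_eq_zero, map_zero]

variable {Y : Type u} [AddCommGroup Y] [Module R Y] [Module (TensorRing R M) Y]
  [IsScalarTower R (TensorRing R M) Y] {p : B →ₗ[TensorRing R M] Y}
  {i : Y →ₗ[TensorRing R M] C}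

/-- An element of the kernel, lifted to M ⊗ B, dies in M ⊗ C by injectivity for C. Exactness at M ⊗
B brings the lift from M ⊗ A, and p ∘ f = 0 finishes the argument. -/
lemma structMap_injective_of_factor (hC : Function.Injective (structMap R M C))
    (hp : Function.Surjective p) (hpf : p ∘ₗ f = 0)
    (ht : Function.Exact (BalTensor.lTensor M (f.restrictScalars R))
      (BalTensor.lTensor M ((i ∘ₗ p).restrictScalars R))) :
    Function.Injective (structMap R M Y) := by
  rw [injective_iff_map_eq_zero]
  intro t h0
  obtain ⟨s, rfl⟩ := BalTensor.lTensor_surjective (f := p.restrictScalars R) hp t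
  have hs : BalTensor.lTensor M ((i ∘ₗ p).restrictScalars R) s = 0 := hC (by
    rw [structMap_lTensor, LinearMap.comp_apply, ← structMap_lTensor, h0, map_zero, map_zero])
  obtain ⟨r, rfl⟩ := (ht s).1 hs
  rw [BalTensor.lTensor_comp_apply]
  have : p.restrictScalars R ∘ₗ f.restrictScalars R = 0 :=
    LinearMap.ext fun a => LinearMap.congr_fun hpf a
  rw [this, BalTensor.lTensor_zero_apply]

/-- If i y comes from t ∈ M ⊗ C, injectivity for D and exactness at M ⊗ C bring t from M ⊗ B, hence
from M ⊗ Y through p. Injectivity of i then puts y in the image of the structure map. -/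
lemma cokerMap_injective_of_factor (hD : Function.Injective (structMap R M D))
    (hi : Function.Injective i) (hhi : h ∘ₗ i = 0)
    (ht : Function.Exact (BalTensor.lTensor M ((i ∘ₗ p).restrictScalars R))
      (BalTensor.lTensor M (h.restrictScalars R))) :
    Function.Injective (cokerMap i) := by
  rw [injective_iff_map_eq_zero]
  intro z hz
  obtain ⟨y, rfl⟩ := Submodule.mkQ_surjective _ z
  obtain ⟨t, hy⟩ := (Submodule.Quotient.mk_eq_zero _).1 hz
  have hy' : structMap R M C t = i y := hy
  obtain ⟨s, rfl⟩ := (ht t).1 (hD (by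
    rw [structMap_lTensor, hy', map_zero]
    exact LinearMap.congr_fun hhi y))
  rw [structMap_lTensor, LinearMap.comp_apply, ← structMap_lTensor] at hy'
  exact (Submodule.Quotient.mk_eq_zero _).2 ⟨_, hi hy'⟩

end ExactSequences

/-! ### The complex of cokernels -/

section Complex

instance (Y : ModuleCat.{u} (TensorRing R M)) : Module R Y := restrictModule R M Y

instance (Y : ModuleCat.{u} (TensorRing R M)) : IsScalarTower R (TensorRing R M) Y :=
  isScalarTower_restrictModule R M Y

/-- The complex of the cokernels of the structure maps. -/
def cokerComplex (T : CochainComplex (ModuleCat.{u} (TensorRing R M)) ℤ) :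
    CochainComplex (ModuleCat.{u} R) ℤ where
  X i := ModuleCat.of R (Coker R M (T.X i))
  d i j := ModuleCat.ofHom (cokerMap (T.d i j).hom)
  shape i j hij := by
    ext x
    change cokerMap (T.d i j).hom ((LinearMap.range (structMap R M (T.X i))).mkQ x) = 0
    rw [cokerMap_mk, T.shape i j hij, ModuleCat.hom_zero, LinearMap.zero_apply, map_zero]
  d_comp_d' i j k _ _ := by
    ext x
    change cokerMap (T.d j k).hom (cokerMap (T.d i j).hom
      ((LinearMap.range (structMap R M (T.X i))).mkQ x)) = 0
    rw [cokerMap_mk, cokerMap_mk, ← LinearMap.comp_apply, ← ModuleCat.hom_comp, T.d_comp_d,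
      ModuleCat.hom_zero, LinearMap.zero_apply, map_zero]

variable {T : CochainComplex (ModuleCat.{u} (TensorRing R M)) ℤ}

lemma d_hom_comp_d_hom {S : Type u} [Ring S] (T : CochainComplex (ModuleCat.{u} S) ℤ) (i j k : ℤ) :
    (T.d j k).hom ∘ₗ (T.d i j).hom = 0 := by
  rw [← ModuleCat.hom_comp, T.d_comp_d, ModuleCat.hom_zero]

/-- Freeing the indices allows use in degree i - 1 with successor written i instead of i - 1 + 1. -/
lemma _root_.HomComplexAcyclic.exact {S : Type u} [Ring S]
    {T : CochainComplex (ModuleCat.{u} S) ℤ} {W : Type u} [AddCommGroup W] [Module S W]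
    (h : HomComplexAcyclic T W) {i j k : ℤ} (hij : i + 1 = j) (hjk : j + 1 = k)
    (g : T.X j →ₗ[S] W) (hg : g ∘ₗ (T.d i j).hom = 0) :
    ∃ g' : T.X k →ₗ[S] W, g' ∘ₗ (T.d j k).hom = g := by
  obtain rfl : i = j - 1 := by lia
  subst hjk
  exact (h j g).1 hg

lemma TensorComplexAcyclic.exact (h : TensorComplexAcyclic R M T) {i j k : ℤ} (hij : i + 1 = j)
    (hjk : j + 1 = k) :
    Function.Exact (BalTensor.lTensor M ((T.d i j).hom.restrictScalars R))
      (BalTensor.lTensor M ((T.d j k).hom.restrictScalars R)) := by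
  obtain rfl : i = j - 1 := by lia
  subst hjk
  exact h j

/-- The complex of cokernels of a totally acyclic complex is acyclic after applying `Hom` to a
flat-cotorsion module. -/
lemma homComplexAcyclic_cokerComplex {N : ℕ} (hN : IsNilpotentBimodule R M N)
    (hcot : PreservesCotorsion R M) (hM : IsCompatible R M) (hT : IsTotallyAcyclicFC T)
    (W : Type u) [AddCommGroup W] [Module R W] (hW : IsFlatCotorsion R W) :
    HomComplexAcyclic (cokerComplex T) W := by
  intro i g
  constructor
  · intro hg
    have hg' : ∀ x, stalkHom g ((T.d (i - 1) i).hom x) = 0 := fun x =>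
      congrArg (toStalk R M W) (LinearMap.congr_fun hg
        ((LinearMap.range (structMap R M (T.X (i - 1)))).mkQ x))
    -- The cocycle with values in the stalk of W is lifted to a cochain G with values in Ind(W);
    -- this is possible since Tⁱ is flat and Ind(M ⊗ W) is cotorsion.
    obtain ⟨G, hG⟩ := (isCotorsionModule_ind hN hcot (hcot W hW.2)).exists_lift
      indShiftIncl_injective indToStalk_surjective indShiftIncl_exact_indToStalk
      (hT.flatCotorsion i).1 (stalkHom (M := M) g)
    obtain ⟨H, hH⟩ := exists_lift_of_exact indShiftIncl_injective indShiftIncl_exact_indToStalk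
      (G ∘ₗ (T.d (i - 1) i).hom) (by
        rw [← LinearMap.comp_assoc, hG]
        exact LinearMap.ext hg')
    -- The coboundary H of G takes values in Ind(M ⊗ W) and is a cocycle there, so compatibility
    -- writes it as the coboundary of some H'.
    obtain ⟨H', hH'⟩ := (hM.hom_acyclic T hT W hW).exact (i := i - 1 - 1) (j := i - 1) (k := i)
      (by lia) (by lia) H (LinearMap.ext fun x => indShiftIncl_injective (by
        rw [← LinearMap.comp_apply, ← LinearMap.comp_assoc, hH, LinearMap.comp_assoc,
          d_hom_comp_d_hom, LinearMap.comp_zero, LinearMap.zero_apply, LinearMap.zero_apply,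
          map_zero]))
    -- Corrected by H', G is a cocycle with values in the flat-cotorsion module Ind(W), hence a
    -- coboundary. The correction disappears in the stalk of W.
    obtain ⟨G', hG'⟩ := (hT.hom_acyclic _ (isFlatCotorsion_ind hN hcot hW)).exact (i := i - 1)
      (j := i) (k := i + 1) (by lia) rfl (G - indShiftIncl R M W ∘ₗ H') (by
        rw [LinearMap.sub_comp, LinearMap.comp_assoc, hH', hH, sub_self])
    obtain ⟨g', hg'⟩ := stalkHom_surjective (indToStalk R M W ∘ₗ G')
    refine ⟨g', LinearMap.ext fun z => ?_⟩
    obtain ⟨x, rfl⟩ := Submodule.mkQ_surjective _ z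
    refine (toStalk R M W).injective ?_
    change stalkHom g' ((T.d i (i + 1)).hom x) = stalkHom g x
    rw [hg', LinearMap.comp_apply]
    refine (congrArg (indToStalk R M W) (LinearMap.congr_fun hG' x)).trans ?_
    rw [LinearMap.sub_apply, map_sub, LinearMap.comp_apply,
      indShiftIncl_exact_indToStalk.apply_apply_eq_zero, sub_zero]
    exact LinearMap.congr_fun hG x
  · rintro ⟨g', rfl⟩
    change (g' ∘ₗ ((cokerComplex T).d i (i + 1)).hom) ∘ₗ ((cokerComplex T).d (i - 1) i).hom = 0
    rw [LinearMap.comp_assoc, d_hom_comp_d_hom, LinearMap.comp_zero]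

/-- The complex of cokernels of a totally acyclic complex of flat-cotorsion modules is totally
acyclic if `M` is compatible. -/
lemma isTotallyAcyclicFC_cokerComplex {N : ℕ} (hN : IsNilpotentBimodule R M N)
    (hcot : PreservesCotorsion R M) (hM : IsCompatible R M) (hT : IsTotallyAcyclicFC T) :
    IsTotallyAcyclicFC (cokerComplex T) where
  flatCotorsion i := isFlatCotorsion_coker hcot (hT.flatCotorsion i)
  -- Exactness of the cokernels in degree i uses exactness of M ⊗ T in degree i + 1.
  exact i := cokerMap_exact_of_exact (h := (T.d (i + 1) (i + 1 + 1)).hom)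
    (structMap_injective_of_flat (hT.flatCotorsion (i + 1 + 1)).1) (hT.exact i)
    (d_hom_comp_d_hom T _ _ _) (TensorComplexAcyclic.exact (hM.tensor_acyclic T hT) rfl rfl)
  hom_acyclic W _ _ hW := homComplexAcyclic_cokerComplex hN hcot hM hT W hW

/-- The structure map of a Gorenstein flat-cotorsion module over `T_R(M)` is injective and its
cokernel is Gorenstein flat-cotorsion. -/
lemma IsGorensteinFlatCotorsion.structMap_injective_and_coker {N : ℕ}
    (hN : IsNilpotentBimodule R M N) (hcot : PreservesCotorsion R M) (hM : IsCompatible R M)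
    {Y : Type u} [AddCommGroup Y] [Module R Y] [Module (TensorRing R M) Y]
    [IsScalarTower R (TensorRing R M) Y] (hY : IsGorensteinFlatCotorsion (TensorRing R M) Y) :
    Function.Injective (structMap R M Y) ∧ IsGorensteinFlatCotorsion R (Coker R M Y) := by
  obtain ⟨T, hT, ⟨e⟩⟩ := hY
  have hσ : ∀ j, Function.Injective (structMap R M (T.X j)) := fun j =>
    structMap_injective_of_flat (hT.flatCotorsion j).1
  have htens := hM.tensor_acyclic T hT
  let i : Y →ₗ[TensorRing R M] T.X 0 := (LinearMap.ker (T.d 0 1).hom).subtype ∘ₗ e.toLinearMap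
  have hi : Function.Injective i := Subtype.val_injective.comp e.injective
  have hid : Function.Exact i (T.d 0 1).hom := fun x =>
    ⟨fun hx => ⟨e.symm ⟨x, hx⟩, by simp [i]⟩, by
      rintro ⟨y, rfl⟩
      exact (e y).2⟩
  have hexact : Function.Exact (T.d (-1) 0).hom (T.d 0 1).hom := hT.exact 0
  obtain ⟨p, hp⟩ := exists_lift_of_exact hi hid (T.d (-1) 0).hom (d_hom_comp_d_hom T _ _ _)
  have hp_surj : Function.Surjective p := fun y => by
    obtain ⟨w, hw⟩ := (hexact (i y)).1 (hid.apply_apply_eq_zero y)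
    exact ⟨w, hi ((LinearMap.congr_fun hp w).trans hw)⟩
  have hpd : p ∘ₗ (T.d (-2) (-1)).hom = 0 := LinearMap.ext fun x => hi (by
    rw [LinearMap.zero_apply, map_zero, ← LinearMap.comp_apply, ← LinearMap.comp_assoc, hp,
      d_hom_comp_d_hom, LinearMap.zero_apply])
  -- Exactness of M ⊗ T in degree -1 gives injectivity of the structure map of Y, in degree 0
  -- injectivity of the map on cokernels induced by Y → T⁰, and in degree 1 the identification of
  -- its image with the kernel.
  have h₁ := TensorComplexAcyclic.exact htens (i := -2) (j := -1) (k := 0) rfl rfl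
  have h₂ := TensorComplexAcyclic.exact htens (i := -1) (j := 0) (k := 1) rfl rfl
  have h₃ := TensorComplexAcyclic.exact htens (i := 0) (j := 1) (k := 2) rfl rfl
  rw [← hp] at h₁ h₂
  refine ⟨structMap_injective_of_factor (hσ 0) hp_surj hpd h₁, cokerComplex T,
    isTotallyAcyclicFC_cokerComplex hN hcot hM hT, ?_⟩
  have hinj := cokerMap_injective_of_factor (hσ 1) hi hid.linearMap_comp_eq_zero h₂
  have hex := cokerMap_exact_of_exact (hσ 2) hid (d_hom_comp_d_hom T 0 1 2) h₃
  exact ⟨(LinearEquiv.ofInjective (cokerMap i) hinj).trans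
    (LinearEquiv.ofEq _ _ (LinearMap.exact_iff.1 hex).symm)⟩

end Complex

end TensorRing

end

theorem proposition3p6 {R : Type u} [Ring R] {M : Type u} [AddCommGroup M] [Module R M]
    [Module Rᵐᵒᵖ M] [SMulCommClass R Rᵐᵒᵖ M] (N : ℕ) (hN : IsNilpotentBimodule R M N)
    (hcot : PreservesCotorsion R M) (hM : IsCompatible R M)
    {X : Type u} [AddCommGroup X] [Module R X] (u : BalTensor R M X →ₗ[R] X)
    (hX : IsGorensteinFlatCotorsion (TensorRing R M) (TensorRing.ModuleOfPair u)) :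
    Function.Injective u ∧ IsGorensteinFlatCotorsion R (X ⧸ LinearMap.range u) := by
  -- The structure map of the pair equals u, but not by definition, and the quotient type depends on
  -- it; hence the transport along an equality.
  have transport : ∀ v : BalTensor R M X →ₗ[R] X, v = u →
      Function.Injective v ∧ IsGorensteinFlatCotorsion R (X ⧸ LinearMap.range v) →
      Function.Injective u ∧ IsGorensteinFlatCotorsion R (X ⧸ LinearMap.range u) := by
    rintro _ rfl h
    exact h
  have h := TensorRing.IsGorensteinFlatCotorsion.structMap_injective_and_coker hN hcot hM hX
  exact transport _ (TensorRing.structMap_pair u) h
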